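/- Let $\mathcal X$ be a measurable space, $\mathcal Y=\{1,\dots,K\}$, and let $P,Q$ (source and target) be probability distributions on $\mathcal X\times\mathcal Y$ with marginals $P_x,Q_x$ on $\mathcal X$. Let $\mathcal F$ be a class of measurable scoring functions $\boldsymbol f=(f_1,\dots,f_K):\mathcal X\to\mathbb R^K$ with $\sum_{k=1}^K f_k(x)=0$ for all $x\in\mathcal X$. Assume the usual measurability of suprema over $\mathcal F$: for every $m$ and every open $U\subseteq(\mathbb R^K)^m$, the set of $(x_1,\dots,x_m)\in\mathcal X^m$ such that $(\boldsymbol f(x_1),\dots,\boldsymbol f(x_m))\in U$ for some $\boldsymbol f\in\mathcal F$ is measurable (this is automatic if $\mathcal F$ is countable, or if every member of $\mathcal F$ is the pointwise limit of a sequence from a fixed countable subset of $\mathcal F$). Fix $\rho>0$. Let $\Phi_\rho(t)=0$ for $t\ge\rho$, $\Phi_\rho(t)=1-t/\rho$ for $0<t<\rho$, and $\Phi_\rho(t)=1$ for $t\le 0$. For $v\in\mathbb R^K$ and $y\in\mathcal Y$ let $\mu_k(v,y)=v_k$ if $k=y$ and $\mu_k(v,y)=-v_k$ if $k\ne y$,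 and let $M^{(\rho)}(v)$ be the $K\times K$ matrix with entries $M^{(\rho)}_{i,j}(v)=\Phi_\rho(\mu_i(v,j))$. With $\|\cdot\|_1$ the sum of the absolute values of the entries, define $$\mathrm{MCSD}^{(\rho)}_D(\boldsymbol f',\boldsymbol f'')=\tfrac1K\,\mathbb E_{x\sim D}\big\|M^{(\rho)}(\boldsymbol f'(x))-M^{(\rho)}(\boldsymbol f''(x))\big\|_1,$$ $$d^{(\rho)}_{MCSD}(D,D')=\sup_{\boldsymbol f',\boldsymbol f''\in\mathcal F}\big[\mathrm{MCSD}^{(\rho)}_{D'}(\boldsymbol f',\boldsymbol f'')-\mathrm{MCSD}^{(\rho)}_{D}(\boldsymbol f',\boldsymbol f'')\big]$$ for distributions $D,D'$ on $\mathcal X$, and $\mathcal E^{(\rho)}_D(\boldsymbol f)=\mathbb E_{(x,y)\sim D}\sum_{k=1}^K\Phi_\rho(\mu_k(\boldsymbol f(x),y))$ for distributions $D$ on $\mathcal X\times\mathcal Y$. Let $\mathcal E_Q(h)=\mathbb E_{(x,y)\sim Q}\mathbb I[h(x)\ne y]$, where $h_{\boldsymbol f}(x)\in\arg\max_k f_k(x)$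 is a measurable labeling function induced by $\boldsymbol f$ (ties may be broken in any way). Let $\lambda=\inf_{\boldsymbol f\in\mathcal F}\big[\mathcal E^{(\rho)}_P(\boldsymbol f)+\mathcal E^{(\rho)}_Q(\boldsymbol f)\big]$ and $\Pi_1(\mathcal F)=\{x\mapsto f_k(x): k\in\mathcal Y,\ \boldsymbol f\in\mathcal F\}$. For a class $\mathcal G$ of real functions and a sample $Z=(z_1,\dots,z_m)$ let $$\widehat{\mathfrak R}_Z(\mathcal G)=\tfrac1m\,\mathbb E_\sigma\sup_{g\in\mathcal G}\sum_{i=1}^m\sigma_i g(z_i)\in(-\infty,+\infty],$$ with $\sigma$ uniform on $\{-1,1\}^m$ (for $\mathcal G\neq\emptyset$). Let $n_s,n_t\ge1$, let $(x^s_1,y^s_1),\dots,(x^s_{n_s},y^s_{n_s})$ be drawn i.i.d. from $P$ and $x^t_1,\dots,x^t_{n_t}$ i.i.d. from $Q_x$; let $\widehat P$ and $\widehat Q_x$ be the corresponding empirical distributions, $\widehat P_x$ the empirical distribution of $\mathcal S=(x^s_i)_{i\le n_s}$, and $\mathcal T=(x^t_j)_{j\le n_t}$. Then for every $\delta>0$,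 with probability at least $1-3\delta$, the following holds for all $\boldsymbol f\in\mathcal F$: $$\begin{aligned}\mathcal E_Q(h_{\boldsymbol f})\le{}&\mathcal E^{(\rho)}_{\widehat P}(\boldsymbol f)+d^{(\rho)}_{MCSD}(\widehat P_x,\widehat Q_x)+\Big(\frac{2K^2}{\rho}+\frac{4K}{\rho}\Big)\widehat{\mathfrak R}_{\mathcal S}(\Pi_1(\mathcal F))+\frac{4K}{\rho}\widehat{\mathfrak R}_{\mathcal T}(\Pi_1(\mathcal F))\\&+6K\sqrt{\frac{\log(4/\delta)}{2n_s}}+3K\sqrt{\frac{\log(4/\delta)}{2n_t}}+\lambda.\end{aligned}$$ -/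

import Mathlib

open MeasureTheory ProbabilityTheory
open scoped ENNReal

noncomputable section

namespace MultiClassUDA

/-- The ramp loss `Φ_ρ`. -/
def rampLoss (ρ x : ℝ) : ℝ :=
  if ρ ≤ x then 0 else if 0 < x then 1 - x / ρ else 1

/-- The absolute margin `μ_k(v, y)` of a score vector `v` at the label `y`:
`+v_k` if `k = y`, and `-v_k` otherwise. -/
def absMargin {K : ℕ} (v : Fin K → ℝ) (y k : Fin K) : ℝ :=
  if k = y then v k else -v k

/-- The matrix of absolute margin violations, `M_{i,j}(v) = Φ_ρ(μ_i(v, j))`. -/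
def violationMatrix {K : ℕ} (ρ : ℝ) (v : Fin K → ℝ) : Matrix (Fin K) (Fin K) ℝ :=
  Matrix.of fun i j => rampLoss ρ (absMargin v j i)

/-- The entrywise `L₁` norm of a matrix. -/
def entrywiseL1 {K : ℕ} (A : Matrix (Fin K) (Fin K) ℝ) : ℝ :=
  ∑ i, ∑ j, |A i j|

variable {X : Type*} [MeasurableSpace X] {K : ℕ}

/-- Multi-class scoring disagreement of `f'` and `f''` with respect to a distribution `D`. -/
def MCSD (ρ : ℝ) (D : Measure X) (f' f'' : X → Fin K → ℝ) : ℝ :=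
  (1 / (K : ℝ)) *
    ∫ x, entrywiseL1 (violationMatrix ρ (f' x) - violationMatrix ρ (f'' x)) ∂D

/-- The MCSD divergence between `Px` and `Qx` with respect to the class `F`, that is
`sup_{f', f'' ∈ F} [MCSD_{Qx}(f', f'') - MCSD_{Px}(f', f'')]`. Each term lies in `[-K, K]` for
measurable `f', f''` and probability measures `Px, Qx`, so this is a genuine supremum. -/
def mcsdDivergence (ρ : ℝ) (F : Set (X → Fin K → ℝ)) (Px Qx : Measure X) : ℝ :=
  ⨆ p : F × F, (MCSD ρ Qx p.1.1 p.2.1 - MCSD ρ Px p.1.1 p.2.1)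

/-- The margin-based risk `E_{(x,y) ∼ D} ∑_k Φ_ρ(μ_k(f(x), y))`. -/
def rampRisk (ρ : ℝ) (D : Measure (X × Fin K)) (f : X → Fin K → ℝ) : ℝ :=
  ∫ z, ∑ k, rampLoss ρ (absMargin (f z.1) z.2 k) ∂D

/-- The zero-one error `E_{(x,y) ∼ D} 1[h(x) ≠ y]` of a labeling function `h`. -/
def zeroOneError (D : Measure (X × Fin K)) (h : X → Fin K) : ℝ :=
  ∫ z, (if h z.1 ≠ z.2 then (1 : ℝ) else 0) ∂D

/-- `h` is a labeling function induced by the scoring function `f`, that is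
`h(x) ∈ argmax_k f_k(x)` for every `x` (with any way of breaking ties). -/
def IsArgmaxLabeling {X : Type*} (f : X → Fin K → ℝ) (h : X → Fin K) : Prop :=
  ∀ x k, f x k ≤ f x (h x)

/-- The optimal joint risk `λ`, the infimum over `f ∈ F` of the sum of the two risks; it is the
minimum whenever the minimum is attained. -/
def jointRisk (ρ : ℝ) (F : Set (X → Fin K → ℝ)) (P Q : Measure (X × Fin K)) : ℝ :=
  ⨅ f : F, (rampRisk ρ P f.1 + rampRisk ρ Q f.1)

/-- The empirical distribution of a sample. -/
def empiricalMeasure {Z : Type*} [MeasurableSpace Z] {m : ℕ} (z : Fin m → Z) : Measure Z :=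
  (m : ℝ≥0∞)⁻¹ • ∑ i, Measure.dirac (z i)

/-- Integrals against the empirical distribution are sample averages. -/
theorem integral_empiricalMeasure {Z : Type*} [MeasurableSpace Z] {m : ℕ} (z : Fin m → Z)
    (g : Z → ℝ) (hg : Measurable g) :
    ∫ t, g t ∂(empiricalMeasure z) = (1 / (m : ℝ)) * ∑ i, g (z i) := by
  have hi : ∀ i ∈ (Finset.univ : Finset (Fin m)), Integrable g (Measure.dirac (z i)) := by
    intro i _
    exact integrable_dirac' hg.stronglyMeasurable (by simp)
  unfold empiricalMeasure
  rw [integral_smul_measure, integral_finsetSum_measure hi]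
  simp [integral_dirac' _ _ hg.stronglyMeasurable]

/-- The empirical Rademacher complexity `(1/m) E_σ sup_{g ∈ G} ∑_i σ_i g(z_i)` of a class `G` of
real-valued functions on the sample `z`, with `σ` uniform on `{-1, 1}^m`. It takes values in the
extended reals, so that the supremum is the true one also when `G` is unbounded on the sample. -/
def empRademacher {Z : Type*} {m : ℕ} (G : Set (Z → ℝ)) (z : Fin m → Z) : EReal :=
  ((1 / (m : ℝ) : ℝ) : EReal) * (((1 / 2 ^ m : ℝ) : EReal) *
    ∑ σ : Fin m → ℤˣ, ⨆ g ∈ G, ((∑ i, ((σ i : ℤ) : ℝ) * g (z i) : ℝ) : EReal))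

/-- The class `Π₁(F) = {x ↦ f_k(x) | k ∈ Y, f ∈ F}` of the components of members of `F`. -/
def Pi1 {X : Type*} (F : Set (X → Fin K → ℝ)) : Set (X → ℝ) :=
  {g | ∃ f ∈ F, ∃ k, g = fun x => f x k}

/-- Measurability of a class of scoring functions: its members are measurable, and for every `m`
and every open `U` the set of the samples `x ∈ X^m` on which some member of `F` takes values in
`U` is measurable. The second part says that suprema over `F` of continuous functions of the
scores on a finite sample are measurable functions of the sample. It is automatic if `F` is
countable, or if every member of `F` is a pointwise limit of members of a fixed countable subset
of `F`. -/
structure IsMeasurableClass (F : Set (X → Fin K → ℝ)) : Prop where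
  measurable : ∀ f ∈ F, Measurable f
  measurableSet_exists : ∀ (m : ℕ) (U : Set (Fin m → Fin K → ℝ)), IsOpen U →
    MeasurableSet {x : Fin m → X | ∃ f ∈ F, (fun i => f (x i)) ∈ U}

end MultiClassUDA

end

/-! For `f, g ∈ F`, two pointwise inequalities on score vectors carry the adaptation argument.
`ite_ne_le_scoringDistance_add` bounds a mistake of an argmax of `f` by the scoring distance of `f`
and `g` plus the margin loss of `g`; this is where the zero-sum constraint enters.
`scoringDistance_le_marginLoss_add` bounds the scoring distance by the sum of the two margin losses.
Integrating the first over `Q` and the second over `P` gives the chain: target error of `f` ≤ MCSD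
on `Q_x` + target risk of `g`; replace `Q_x` by its sample, pass to the source sample at the cost of
the divergence, return to `P_x`, bound MCSD there by the two source risks, and replace the source
risk of `f` by its empirical value. The infimum over `g` produces `λ`.

The chain uses three one-sided uniform deviations: margin risk on the source sample, and MCSD on
each sample. All come from `exists_uniform_deviation`: McDiarmid's inequality is applied once to the
ghost-sample supremum minus twice the empirical Rademacher average, a function with bounded
differences `3B` and nonpositive mean by symmetrization. Thus each deviation costs only one `δ`.

The complexities of the two composite classes reduce to that of `Pi1 F` by subadditivity and the
contraction principle: `K` ramp terms give `K / ρ`, and `K²` matrix entries weighted by `1 / K`,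
each a difference of two ramps, give `2K / ρ`. -/

namespace MultiClassUDA

/-! ### Concentration under bounded differences. -/

/-- **McDiarmid's inequality** in moment generating form: a bounded measurable function of `n`
i.i.d. variables whose value changes by at most `c` when one variable changes is sub-Gaussian with
variance proxy `n * (c / 2) ^ 2`. -/
theorem hasSubgaussianMGF_of_bounded_differences {Z : Type*} [MeasurableSpace Z] (P : Measure Z)
    [IsProbabilityMeasure P] {B c : ℝ} (n : ℕ) (f : (Fin n → Z) → ℝ) (hf : Measurable f)
    (hB : ∀ z, |f z| ≤ B) (hc : ∀ z j a, |f z - f (Function.update z j a)| ≤ c) :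
    HasSubgaussianMGF (fun z => f z - ∫ w, f w ∂(Measure.pi fun _ => P))
      (n * (‖c‖₊ / 2) ^ 2) (Measure.pi fun _ => P) := by
  induction n with
  | zero =>
    have h : ∀ z, f z - ∫ w, f w ∂(Measure.pi fun _ : Fin 0 => P) = 0 := by
      intro z
      have : ∀ w, f w = f z := fun w => congrArg f (Subsingleton.elim _ _)
      simp [this]
    simp only [h]
    simp
  | succ n ih =>
    set pn : Measure (Fin n → Z) := Measure.pi fun _ => P with hpn
    -- Averaging out the first coordinate preserves bounded differences in the others, so induction
    -- applies to `g`; the remaining fluctuation in the first coordinate is handled by Hoeffding's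
    -- lemma with the tail `w` fixed.
    set g : (Fin n → Z) → ℝ := fun w => ∫ a, f (Fin.cons a w) ∂P with hg
    have hcons : Measurable fun p : Z × (Fin n → Z) => (Fin.cons p.1 p.2 : Fin (n + 1) → Z) := by
      refine measurable_pi_lambda _ fun j => ?_
      refine Fin.cases ?_ (fun i => ?_) j
      · exact measurable_fst
      · exact (measurable_pi_apply i).comp measurable_snd
    have hfm : Measurable fun p : Z × (Fin n → Z) => f (Fin.cons p.1 p.2) := hf.comp hcons
    have hfa : ∀ w, Measurable fun a => f (Fin.cons a w) := fun w =>
      hfm.comp (measurable_id.prodMk measurable_const)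
    have hint : ∀ w, Integrable (fun a => f (Fin.cons a w)) P := fun w =>
      Integrable.of_bound (hfa w).aestronglyMeasurable B
        (ae_of_all _ fun a => by simpa using hB _)
    have hgm : Measurable g := by
      have : Measurable fun p : (Fin n → Z) × Z => f (Fin.cons p.2 p.1) := hfm.comp measurable_swap
      exact this.stronglyMeasurable.integral_prod_right'.measurable
    have hgB : ∀ w, |g w| ≤ B := by
      intro w
      have := norm_integral_le_of_norm_le_const (μ := P) (f := fun a => f (Fin.cons a w)) (C := B)
        (ae_of_all _ fun a => by simpa using hB _)
      simpa using this
    have hgc : ∀ w j b, |g w - g (Function.update w j b)| ≤ c := by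
      intro w j b
      have h1 : g w - g (Function.update w j b)
          = ∫ a, (f (Fin.cons a w) - f (Fin.cons a (Function.update w j b))) ∂P :=
        (integral_sub (hint _) (hint _)).symm
      rw [h1]
      have := norm_integral_le_of_norm_le_const (μ := P)
        (f := fun a => f (Fin.cons a w) - f (Fin.cons a (Function.update w j b))) (C := c)
        (ae_of_all _ fun a => by
          have := hc (Fin.cons a w) j.succ b
          rw [← Fin.cons_update] at this
          simpa using this)
      simpa using this
    have ihg := ih g hgm hgB hgc
    have hmp : MeasurePreserving (fun p : Z × (Fin n → Z) => (Fin.cons p.1 p.2 : Fin (n + 1) → Z))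
        (P.prod pn) (Measure.pi fun _ => P) := by
      have := (measurePreserving_piFinSuccAbove (fun _ : Fin (n + 1) => P) 0).symm
      convert this using 1
      ext p j
      simp [MeasurableEquiv.piFinSuccAbove, Fin.insertNthEquiv]
    have hE : ∀ φ : ℝ → ℝ, Measurable φ → (∃ C, ∀ z, |φ (f z)| ≤ C) →
        ∫ z, φ (f z) ∂(Measure.pi fun _ => P) = ∫ w, ∫ a, φ (f (Fin.cons a w)) ∂P ∂pn := by
      rintro φ hφ ⟨C, hC⟩
      rw [← hmp.map_eq, integral_map hcons.aemeasurable (f := fun z => φ (f z))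
        (hφ.comp hf).aestronglyMeasurable,
        integral_prod_symm]
      exact Integrable.of_bound (hφ.comp hfm).aestronglyMeasurable C
        (ae_of_all _ fun a => by simpa using hC _)
    set m := ∫ w, f w ∂(Measure.pi fun _ => P) with hm
    have hmg : m = ∫ w, g w ∂pn := hE id measurable_id ⟨B, hB⟩
    refine ⟨fun t => ?_, fun t => ?_⟩
    · refine integrable_exp_mul_of_mem_Icc (a := -B - m) (b := B - m)
        (hf.sub_const m).aemeasurable (ae_of_all _ fun z => ?_)
      have := abs_le.1 (hB z)
      constructor <;> linarith
    · have hexp : ∀ x : ℝ, |x| ≤ B → |Real.exp (t * (x - m))| ≤ Real.exp (|t| * (B + |m|)) := by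
        intro x hx
        rw [abs_of_pos (Real.exp_pos _)]
        refine Real.exp_le_exp.2 ((le_abs_self _).trans ?_)
        rw [abs_mul]
        gcongr
        exact (abs_sub _ _).trans (by gcongr)
      have h1 : mgf (fun z => f z - m) (Measure.pi fun _ => P) t
          = ∫ w, ∫ a, Real.exp (t * (f (Fin.cons a w) - m)) ∂P ∂pn :=
        hE (fun x => Real.exp (t * (x - m))) (by fun_prop) ⟨_, fun z => hexp _ (hB z)⟩
      have h2 : ∀ w, ∫ a, Real.exp (t * (f (Fin.cons a w) - m)) ∂P
          ≤ Real.exp (((‖c‖₊ / 2) ^ 2 : NNReal) * t ^ 2 / 2) * Real.exp (t * (g w - m)) := by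
        intro w
        obtain ⟨a₀⟩ : Nonempty Z := P.nonempty_of_neZero
        have hbdd : BddBelow (Set.range fun a => f (Fin.cons a w)) :=
          ⟨-B, by rintro _ ⟨a, rfl⟩; exact (abs_le.1 (hB _)).1⟩
        set lo := ⨅ a, f (Fin.cons a w) with hlo
        have : Nonempty Z := ⟨a₀⟩
        have hsub : HasSubgaussianMGF (fun a => f (Fin.cons a w) - ∫ a, f (Fin.cons a w) ∂P)
            ((‖(lo + c) - lo‖₊ / 2) ^ 2) P := by
          refine hasSubgaussianMGF_of_mem_Icc (hfa w).aemeasurable (ae_of_all _ fun a => ?_)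
          refine ⟨ciInf_le hbdd a, ?_⟩
          rw [← sub_le_iff_le_add]
          refine le_ciInf fun b => ?_
          have := hc (Fin.cons a w) 0 b
          rw [Fin.update_cons_zero] at this
          linarith [(abs_le.1 this).2]
        rw [add_sub_cancel_left] at hsub
        have h3 := hsub.mgf_le t
        have h4 : ∀ a, Real.exp (t * (f (Fin.cons a w) - m))
            = Real.exp (t * (f (Fin.cons a w) - g w)) * Real.exp (t * (g w - m)) := by
          intro a; rw [← Real.exp_add]; ring_nf
        simp_rw [h4]
        rw [integral_mul_const]
        gcongr
        exact h3
      have h5 : Integrable (fun w => ∫ a, Real.exp (t * (f (Fin.cons a w) - m)) ∂P) pn := by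
        refine Integrable.of_bound (C := Real.exp (|t| * (B + |m|))) ?_ (ae_of_all _ fun w => ?_)
        · have : Measurable fun p : (Fin n → Z) × Z => Real.exp (t * (f (Fin.cons p.2 p.1) - m)) :=
            (((hfm.comp measurable_swap).sub_const m).const_mul t).exp
          exact this.stronglyMeasurable.integral_prod_right'.aestronglyMeasurable
        · have := norm_integral_le_of_norm_le_const (μ := P)
            (f := fun a => Real.exp (t * (f (Fin.cons a w) - m))) (C := Real.exp (|t| * (B + |m|)))
            (ae_of_all _ fun a => by simpa using hexp _ (hB _))
          simpa using this
      rw [h1]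
      refine (integral_mono h5 ((ihg.integrable_exp_mul t).const_mul
        (Real.exp (((‖c‖₊ / 2) ^ 2 : NNReal) * t ^ 2 / 2))) fun w => ?_).trans ?_
      · simpa only [← hmg] using h2 w
      · rw [integral_const_mul]
        refine (mul_le_mul_of_nonneg_left (ihg.mgf_le t) (Real.exp_pos _).le).trans_eq ?_
        rw [← Real.exp_add]
        congr 1
        push_cast
        ring

/-! ### Rademacher averages and contraction. -/

/-- The unnormalized real-valued Rademacher complexity `∑_σ sup_i ∑_j σ_j t_{i,j}` of a family of
vectors. -/
noncomputable def rademacherSum {ι : Type*} {m : ℕ} (t : ι → Fin m → ℝ) : ℝ :=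
  ∑ σ : Fin m → ℤˣ, ⨆ i, ∑ j, ((σ j : ℤ) : ℝ) * t i j

theorem abs_unit_cast (s : ℤˣ) : |((s : ℤ) : ℝ)| = 1 := by
  rcases Int.units_eq_one_or s with rfl | rfl <;> simp

theorem abs_sum_sign_mul_le {m : ℕ} (σ : Fin m → ℤˣ) {v : Fin m → ℝ} {C : ℝ}
    (hv : ∀ j, |v j| ≤ C) : |∑ j, ((σ j : ℤ) : ℝ) * v j| ≤ m * C := by
  refine (Finset.abs_sum_le_sum_abs _ _).trans ?_
  refine (Finset.sum_le_card_nsmul _ _ C fun j _ => ?_).trans_eq (by simp)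
  rw [abs_mul, abs_unit_cast, one_mul]
  exact hv j

theorem bddAbove_range_of_abs_le {ι : Type*} {f : ι → ℝ} {C : ℝ} (h : ∀ i, |f i| ≤ C) :
    BddAbove (Set.range f) :=
  ⟨C, by rintro _ ⟨i, rfl⟩; exact (abs_le.1 (h i)).2⟩

theorem bddAbove_range_sum_sign_mul {ι : Type*} {m : ℕ} {t : ι → Fin m → ℝ} {C : ℝ}
    (ht : ∀ i j, |t i j| ≤ C) (σ : Fin m → ℤˣ) :
    BddAbove (Set.range fun i => ∑ j, ((σ j : ℤ) : ℝ) * t i j) :=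
  bddAbove_range_of_abs_le fun i => abs_sum_sign_mul_le σ (ht i)

theorem sum_sum_sign_mul {m : ℕ} (v : Fin m → ℝ) :
    ∑ σ : Fin m → ℤˣ, ∑ j, ((σ j : ℤ) : ℝ) * v j = 0 := by
  have h := Equiv.sum_comp (Equiv.neg (Fin m → ℤˣ)) fun σ => ∑ j, ((σ j : ℤ) : ℝ) * v j
  have h' : ∑ σ : Fin m → ℤˣ, ∑ j, (((Equiv.neg (Fin m → ℤˣ) σ) j : ℤ) : ℝ) * v j
      = -∑ σ : Fin m → ℤˣ, ∑ j, ((σ j : ℤ) : ℝ) * v j := by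
    simp [← Finset.sum_neg_distrib]
  linarith

/-- A single member already contributes zero in total over all signs, by the symmetry `σ ↦ -σ`. -/
theorem rademacherSum_nonneg {ι : Type*} [Nonempty ι] {m : ℕ} {t : ι → Fin m → ℝ} {C : ℝ}
    (ht : ∀ i j, |t i j| ≤ C) : 0 ≤ rademacherSum t := by
  obtain ⟨i₀⟩ := ‹Nonempty ι›
  rw [← sum_sum_sign_mul (t i₀)]
  exact Finset.sum_le_sum fun σ _ => le_ciSup (bddAbove_range_sum_sign_mul ht σ) i₀

theorem rademacherSum_add_le {ι : Type*} [Nonempty ι] {m : ℕ} {s t : ι → Fin m → ℝ} {C D : ℝ}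
    (hs : ∀ i j, |s i j| ≤ C) (ht : ∀ i j, |t i j| ≤ D) :
    rademacherSum (fun i j => s i j + t i j) ≤ rademacherSum s + rademacherSum t := by
  unfold rademacherSum
  rw [← Finset.sum_add_distrib]
  refine Finset.sum_le_sum fun σ _ => ciSup_le fun i => ?_
  simp only [mul_add, Finset.sum_add_distrib]
  exact add_le_add (le_ciSup (bddAbove_range_sum_sign_mul hs σ) i)
    (le_ciSup (bddAbove_range_sum_sign_mul ht σ) i)

theorem rademacherSum_sum_le {ι κ : Type*} [Nonempty ι] {m : ℕ} (A : Finset κ)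
    {t : κ → ι → Fin m → ℝ} {C : ℝ} (ht : ∀ k i j, |t k i j| ≤ C) :
    rademacherSum (fun i j => ∑ k ∈ A, t k i j) ≤ ∑ k ∈ A, rademacherSum (t k) := by
  unfold rademacherSum
  rw [Finset.sum_comm]
  refine Finset.sum_le_sum fun σ _ => ciSup_le fun i => ?_
  simp only [Finset.mul_sum]
  rw [Finset.sum_comm]
  exact Finset.sum_le_sum fun k _ => le_ciSup (bddAbove_range_sum_sign_mul (ht k) σ) i

theorem rademacherSum_comp_le {ι κ : Type*} [Nonempty κ] {m : ℕ} {t : ι → Fin m → ℝ} {C : ℝ}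
    (ht : ∀ i j, |t i j| ≤ C) (e : κ → ι) :
    rademacherSum (fun k => t (e k)) ≤ rademacherSum t :=
  Finset.sum_le_sum fun σ _ => ciSup_le fun k =>
    le_ciSup (bddAbove_range_sum_sign_mul ht σ) (e k)

theorem sum_units_int {M : Type*} [AddCommMonoid M] (f : ℤˣ → M) : ∑ s, f s = f 1 + f (-1) := by
  rw [show (Finset.univ : Finset ℤˣ) = {1, -1} from rfl]
  exact Finset.sum_pair (by decide)

/-- The two-point case of contraction. For competitors `i`, `k` in the two suprema, `φ (t i) - φ (t
k) ≤ L * |t i - t k|`; the index with the larger `t` is then used in the supremum with `+L`, the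
other in the one with `-L`. -/
theorem ciSup_add_ciSup_sub_le {ι : Type*} [Nonempty ι] {w t : ι → ℝ} {φ : ℝ → ℝ} {L : ℝ}
    (hφ : ∀ x y, |φ x - φ y| ≤ L * |x - y|)
    (h1 : BddAbove (Set.range fun i => w i + L * t i))
    (h2 : BddAbove (Set.range fun i => w i - L * t i)) :
    (⨆ i, (w i + φ (t i))) + (⨆ i, (w i - φ (t i)))
      ≤ (⨆ i, (w i + L * t i)) + (⨆ i, (w i - L * t i)) := by
  have key : ∀ i k, (w i + φ (t i)) + (w k - φ (t k))
      ≤ (⨆ i, (w i + L * t i)) + (⨆ i, (w i - L * t i)) := by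
    intro i k
    have h := (le_abs_self _).trans (hφ (t i) (t k))
    rcases abs_cases (t i - t k) with ⟨e, _⟩ | ⟨e, _⟩
    · have := le_ciSup h1 i
      have := le_ciSup h2 k
      rw [e] at h
      linarith
    · have := le_ciSup h1 k
      have := le_ciSup h2 i
      rw [e] at h
      linarith
  rw [← le_sub_iff_add_le]
  refine ciSup_le fun i => ?_
  rw [le_sub_comm]
  refine ciSup_le fun k => ?_
  linarith [key i k]

/-- Signs are peeled off one at a time. The free offset `u` lets the induction carry the term
already peeled off, and `φ` depends on `j` because the label of the `j`-th point will choose the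
sign of the margin. -/
theorem sum_ciSup_lipschitz_le {ι : Type*} [Nonempty ι] {L D : ℝ} (hL : 0 ≤ L) (m : ℕ)
    (t : ι → Fin m → ℝ) (u : ι → ℝ) (φ : Fin m → ℝ → ℝ) {C : ℝ}
    (hφ : ∀ j x y, |φ j x - φ j y| ≤ L * |x - y|)
    (hu : ∀ i, |u i| ≤ C) (ht : ∀ i j, |t i j| ≤ D) :
    ∑ σ : Fin m → ℤˣ, ⨆ i, (u i + ∑ j, ((σ j : ℤ) : ℝ) * φ j (t i j))
      ≤ ∑ σ : Fin m → ℤˣ, ⨆ i, (u i + ∑ j, ((σ j : ℤ) : ℝ) * (L * t i j)) := by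
  induction m generalizing u C with
  | zero => simp
  | succ n ih =>
    have hsplit : ∀ ψ : ι → Fin (n + 1) → ℝ,
        ∑ σ : Fin (n + 1) → ℤˣ, ⨆ i, (u i + ∑ j, ((σ j : ℤ) : ℝ) * ψ i j)
        = ∑ s : ℤˣ, ∑ σ : Fin n → ℤˣ, ⨆ i, ((u i + ((s : ℤ) : ℝ) * ψ i 0)
            + ∑ j, ((σ j : ℤ) : ℝ) * ψ i j.succ) := by
      intro ψ
      rw [← Equiv.sum_comp (Fin.consEquiv fun _ : Fin (n + 1) => ℤˣ), Fintype.sum_prod_type]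
      simp [Fin.consEquiv, Fin.sum_univ_succ, add_assoc]
    rw [hsplit fun i j => φ j (t i j), hsplit fun i j => L * t i j]
    have hub : ∀ s : ℤˣ, ∀ i, |u i + ((s : ℤ) : ℝ) * φ 0 (t i 0)|
        ≤ C + (|φ 0 0| + L * D) := by
      intro s i
      refine (abs_add_le _ _).trans (add_le_add (hu i) ?_)
      rw [abs_mul, abs_unit_cast, one_mul]
      have h1 := hφ 0 (t i 0) 0
      have h2 : L * |t i 0 - 0| ≤ L * D := by
        rw [sub_zero]; exact mul_le_mul_of_nonneg_left (ht i 0) hL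
      have h3 := abs_sub_abs_le_abs_sub (φ 0 (t i 0)) (φ 0 0)
      linarith
    refine (Finset.sum_le_sum fun (s : ℤˣ) _ => ih (fun i j => t i j.succ)
      (fun i => u i + ((s : ℤ) : ℝ) * φ 0 (t i 0)) (fun j => φ j.succ)
      (fun j => hφ j.succ) (hub s) (fun i j => ht i j.succ)).trans ?_
    rw [Finset.sum_comm, Finset.sum_comm (s := (Finset.univ : Finset ℤˣ))]
    refine Finset.sum_le_sum fun σ _ => ?_
    rw [sum_units_int, sum_units_int]
    -- The tail has been linearized by induction; `w` collects it with `u`, leaving the two values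
    -- of the first sign for the two-point inequality.
    set w : ι → ℝ := fun i => u i + ∑ j, ((σ j : ℤ) : ℝ) * (L * t i j.succ) with hw
    have hLt : ∀ i j, |L * t i j| ≤ L * D := fun i j => by
      rw [abs_mul, abs_of_nonneg hL]; exact mul_le_mul_of_nonneg_left (ht i j) hL
    have hwb : ∀ i, |w i| ≤ C + n * (L * D) := fun i =>
      (abs_add_le _ _).trans (add_le_add (hu i) (abs_sum_sign_mul_le σ fun j => hLt i j.succ))
    have h := ciSup_add_ciSup_sub_le (w := w) (t := fun i => t i 0) (φ := φ 0) (L := L) (hφ 0)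
      (bddAbove_range_of_abs_le (C := (C + n * (L * D)) + L * D)
        fun i => (abs_add_le _ _).trans (add_le_add (hwb i) (hLt i 0)))
      (bddAbove_range_of_abs_le (C := (C + n * (L * D)) + L * D)
        fun i => (abs_sub _ _).trans (add_le_add (hwb i) (hLt i 0)))
    refine (le_of_eq ?_).trans (h.trans_eq ?_) <;> congr 1 <;>
      refine iSup_congr fun i => ?_ <;> simp [hw] <;> ring

/-- **Contraction principle** for Rademacher averages. -/
theorem rademacherSum_lipschitz_le {ι : Type*} [Nonempty ι] {L D : ℝ} (hL : 0 ≤ L) {m : ℕ}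
    {t : ι → Fin m → ℝ} {φ : Fin m → ℝ → ℝ} (hφ : ∀ j x y, |φ j x - φ j y| ≤ L * |x - y|)
    (ht : ∀ i j, |t i j| ≤ D) :
    rademacherSum (fun i j => φ j (t i j)) ≤ L * rademacherSum t := by
  have h := sum_ciSup_lipschitz_le hL m t (fun _ => 0) φ (C := 0) hφ (by simp) ht
  simp only [zero_add] at h
  refine h.trans_eq ?_
  unfold rademacherSum
  rw [Finset.mul_sum]
  refine Finset.sum_congr rfl fun σ _ => ?_
  rw [Real.mul_iSup_of_nonneg hL]
  refine iSup_congr fun i => ?_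
  rw [Finset.mul_sum]
  exact Finset.sum_congr rfl fun j _ => by ring

/-! ### Symmetrization and uniform deviations for bounded families. -/

theorem abs_ciSup_sub_ciSup_le {ι : Type*} [Nonempty ι] {f g : ι → ℝ} {B : ℝ}
    (hf : BddAbove (Set.range f)) (hg : BddAbove (Set.range g)) (h : ∀ i, |f i - g i| ≤ B) :
    |(⨆ i, f i) - ⨆ i, g i| ≤ B := by
  rw [abs_le]
  constructor
  · rw [neg_le_sub_iff_le_add]
    refine ciSup_le fun i => ?_
    linarith [(abs_le.1 (h i)).1, le_ciSup hf i]
  · rw [sub_le_iff_le_add]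
    refine ciSup_le fun i => ?_
    linarith [(abs_le.1 (h i)).2, le_ciSup hg i]

theorem abs_ciSup_le {ι : Type*} [Nonempty ι] {f : ι → ℝ} {B : ℝ} (h : ∀ i, |f i| ≤ B) :
    |⨆ i, f i| ≤ B := by
  have := abs_ciSup_sub_ciSup_le (f := f) (g := fun _ => 0) (bddAbove_range_of_abs_le h)
    (by simp) (by simpa using h)
  simpa using this

/-- A family of measurable functions with values in `[-C, C]` and oscillation at most `B`, such
that suprema over the family of weighted sample sums are measurable functions of the sample. -/
structure IsBoundedMeasurableFamily {ι Z : Type*} [MeasurableSpace Z] (ℓ : ι → Z → ℝ)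
    (C B : ℝ) : Prop where
  measurable : ∀ i, Measurable (ℓ i)
  abs_le : ∀ i z, |ℓ i z| ≤ C
  abs_sub_le : ∀ i z z', |ℓ i z - ℓ i z'| ≤ B
  measurable_iSup : ∀ (n : ℕ) (a : Fin n → ℝ),
    Measurable fun z : Fin n → Z => ⨆ i, ∑ j, a j * ℓ i (z j)

/-- The largest difference over the family between the sums over a ghost sample `z'` and over a
sample `z`. -/
noncomputable def ghostSup {ι Z : Type*} {m : ℕ} (ℓ : ι → Z → ℝ) (z z' : Fin m → Z) : ℝ :=
  ⨆ i, ∑ j, (ℓ i (z' j) - ℓ i (z j))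

namespace IsBoundedMeasurableFamily

variable {ι Z : Type*} [MeasurableSpace Z] {ℓ : ι → Z → ℝ} {C B : ℝ} {m : ℕ}

/-- The two samples are joined into one of size `m + m`, with weights `+1` on the ghost half and
`-1` on the other. -/
theorem measurable_ghostSup (h : IsBoundedMeasurableFamily ℓ C B) :
    Measurable fun p : (Fin m → Z) × (Fin m → Z) => ghostSup ℓ p.1 p.2 := by
  have hap : Measurable fun p : (Fin m → Z) × (Fin m → Z) => Fin.append p.2 p.1 := by
    refine measurable_pi_lambda _ fun j => ?_
    refine Fin.addCases (fun i => ?_) (fun i => ?_) j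
    · simp only [Fin.append_left]
      exact (measurable_pi_apply i).comp measurable_snd
    · simp only [Fin.append_right]
      exact (measurable_pi_apply i).comp measurable_fst
  have := (h.measurable_iSup (m + m) (Fin.append (fun _ => 1) fun _ => -1)).comp hap
  convert this using 1
  funext p
  simp only [ghostSup, Function.comp_apply, Fin.sum_univ_add, Fin.append_left, Fin.append_right,
    ← Finset.sum_add_distrib]
  exact iSup_congr fun i => Finset.sum_congr rfl fun j _ => by ring

theorem abs_sum_sub_le (h : IsBoundedMeasurableFamily ℓ C B) (z z' : Fin m → Z) (i : ι) :
    |∑ j, (ℓ i (z' j) - ℓ i (z j))| ≤ m * B := by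
  refine (Finset.abs_sum_le_sum_abs _ _).trans ?_
  exact (Finset.sum_le_card_nsmul _ _ B fun j _ => h.abs_sub_le _ _ _).trans_eq (by simp)

theorem abs_ghostSup_le [Nonempty ι] (h : IsBoundedMeasurableFamily ℓ C B) (z z' : Fin m → Z) :
    |ghostSup ℓ z z'| ≤ m * B :=
  abs_ciSup_le (h.abs_sum_sub_le z z')

theorem abs_sum_update_sub_le (h : IsBoundedMeasurableFamily ℓ C B) (c : Fin m → ℝ)
    (hc : ∀ j, |c j| = 1) (i : ι) (z : Fin m → Z) (k : Fin m) (a : Z) :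
    |∑ j, c j * ℓ i (z j) - ∑ j, c j * ℓ i (Function.update z k a j)| ≤ B := by
  rw [← Finset.sum_sub_distrib, Finset.sum_eq_single k]
  · rw [← mul_sub, abs_mul, hc, one_mul]
    exact h.abs_sub_le _ _ _
  · intro j _ hj
    rw [Function.update_of_ne hj, sub_self]
  · simp

theorem abs_ghostSup_sub_update_le [Nonempty ι] (h : IsBoundedMeasurableFamily ℓ C B) (z z' : Fin m → Z)
    (k : Fin m) (a : Z) : |ghostSup ℓ z z' - ghostSup ℓ (Function.update z k a) z'| ≤ B := by
  refine abs_ciSup_sub_ciSup_le (bddAbove_range_of_abs_le (h.abs_sum_sub_le _ _))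
    (bddAbove_range_of_abs_le (h.abs_sum_sub_le _ _)) fun i => ?_
  have := h.abs_sum_update_sub_le (fun _ => -1) (by simp) i z k a
  convert this using 2
  simp only [Finset.sum_sub_distrib, neg_mul, one_mul, Finset.sum_neg_distrib]
  ring

theorem measurable_rademacherSum (h : IsBoundedMeasurableFamily ℓ C B) :
    Measurable fun z : Fin m → Z => rademacherSum fun i j => ℓ i (z j) :=
  Finset.measurable_sum _ fun _ _ => h.measurable_iSup _ _

theorem abs_ciSup_sign_le [Nonempty ι] (h : IsBoundedMeasurableFamily ℓ C B) (σ : Fin m → ℤˣ)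
    (z : Fin m → Z) : |⨆ i, ∑ j, ((σ j : ℤ) : ℝ) * ℓ i (z j)| ≤ m * C :=
  abs_ciSup_le fun i => abs_sum_sign_mul_le σ fun j => h.abs_le i (z j)

theorem card_signs (m : ℕ) : ((Finset.univ : Finset (Fin m → ℤˣ)).card : ℝ) = 2 ^ m := by
  simp [Fintype.card_pi]

theorem abs_rademacherSum_le [Nonempty ι] (h : IsBoundedMeasurableFamily ℓ C B) (z : Fin m → Z) :
    |rademacherSum fun i j => ℓ i (z j)| ≤ 2 ^ m * (m * C) := by
  refine (Finset.abs_sum_le_sum_abs _ _).trans ?_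
  refine (Finset.sum_le_card_nsmul _ _ _ fun σ _ => h.abs_ciSup_sign_le σ z).trans_eq ?_
  rw [nsmul_eq_mul, card_signs]

theorem abs_rademacherSum_sub_update_le [Nonempty ι] (h : IsBoundedMeasurableFamily ℓ C B) (z : Fin m → Z)
    (k : Fin m) (a : Z) :
    |rademacherSum (fun i j => ℓ i (z j))
      - rademacherSum (fun i j => ℓ i (Function.update z k a j))| ≤ 2 ^ m * B := by
  unfold rademacherSum
  rw [← Finset.sum_sub_distrib]
  refine (Finset.abs_sum_le_sum_abs _ _).trans ?_
  refine (Finset.sum_le_card_nsmul _ _ B fun σ _ => ?_).trans_eq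
    (by rw [nsmul_eq_mul, card_signs])
  exact abs_ciSup_sub_ciSup_le (bddAbove_range_sum_sign_mul (fun i j => h.abs_le i _) σ)
    (bddAbove_range_sum_sign_mul (fun i j => h.abs_le i _) σ) fun i =>
    h.abs_sum_update_sub_le _ (fun j => abs_unit_cast (σ j)) i z k a

variable [Nonempty ι] (P : Measure Z) [IsProbabilityMeasure P]

theorem integrable_ghostSup_left (h : IsBoundedMeasurableFamily ℓ C B) (z : Fin m → Z) :
    Integrable (ghostSup ℓ z) (Measure.pi fun _ => P) :=
  Integrable.of_bound (h.measurable_ghostSup.comp measurable_prodMk_left).aestronglyMeasurable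
    (m * B) (ae_of_all _ fun z' => h.abs_ghostSup_le z z')

/-- The true mean is the mean over a ghost sample, and the supremum of integrals is at most the
integral of the supremum. Working with the right side requires only measurability of suprema of
finite sample sums. -/
theorem sum_integral_sub_le (h : IsBoundedMeasurableFamily ℓ C B) (z : Fin m → Z) (i : ι) :
    ∑ j, (∫ t, ℓ i t ∂P - ℓ i (z j)) ≤ ∫ z', ghostSup ℓ z z' ∂(Measure.pi fun _ => P) := by
  have hint : ∀ j, Integrable (fun z' : Fin m → Z => ℓ i (z' j)) (Measure.pi fun _ => P) :=
    fun j => Integrable.of_bound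
      ((h.measurable i).comp (measurable_pi_apply j)).aestronglyMeasurable C
      (ae_of_all _ fun z' => h.abs_le i _)
  have h1 : ∑ j, (∫ t, ℓ i t ∂P - ℓ i (z j))
      = ∫ z' : Fin m → Z, ∑ j, (ℓ i (z' j) - ℓ i (z j)) ∂(Measure.pi fun _ => P) := by
    refine ((integral_finsetSum _ fun j _ =>
      (hint j).sub (integrable_const (ℓ i (z j)))).trans ?_).symm
    refine Finset.sum_congr rfl fun j _ => ?_
    refine (integral_sub (hint j) (integrable_const _)).trans ?_
    have := integral_comp_eval (μ := fun _ : Fin m => P) (i := j)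
      (h.measurable i).aestronglyMeasurable
    rw [this]
    simp
  rw [h1]
  refine integral_mono (integrable_finsetSum _ fun j _ => (hint j).sub (integrable_const _))
    (h.integrable_ghostSup_left P z) fun z' => ?_
  exact le_ciSup (bddAbove_range_of_abs_le (h.abs_sum_sub_le z z')) i

/-- **Symmetrization.** -/
theorem integral_ghostSup_le (h : IsBoundedMeasurableFamily ℓ C B) :
    2 ^ m * ∫ z : Fin m → Z, ∫ z', ghostSup ℓ z z' ∂(Measure.pi fun _ => P)
        ∂(Measure.pi fun _ => P)
      ≤ 2 * ∫ z : Fin m → Z, rademacherSum (fun i j => ℓ i (z j)) ∂(Measure.pi fun _ => P) := by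
  set pm : Measure (Fin m → Z) := Measure.pi fun _ => P with hpm
  set W : Measure (Fin m → Z × Z) := Measure.pi fun _ => P.prod P with hW
  have harr : MeasurePreserving
      (fun w : Fin m → Z × Z => ((fun j => (w j).1, fun j => (w j).2) :
        (Fin m → Z) × (Fin m → Z))) W (pm.prod pm) :=
    measurePreserving_arrowProdEquivProdArrow Z Z (Fin m) (fun _ => P) (fun _ => P)
  have hfst : MeasurePreserving (fun (w : Fin m → Z × Z) j => (w j).1) W pm :=
    measurePreserving_fst.comp harr
  have hsnd : MeasurePreserving (fun (w : Fin m → Z × Z) j => (w j).2) W pm :=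
    measurePreserving_snd.comp harr
  have hG : Integrable (fun p : (Fin m → Z) × (Fin m → Z) => ghostSup ℓ p.1 p.2)
      (pm.prod pm) :=
    Integrable.of_bound h.measurable_ghostSup.aestronglyMeasurable (m * B)
      (ae_of_all _ fun p => h.abs_ghostSup_le _ _)
  set A : (Fin m → ℤˣ) → (Fin m → Z) → ℝ := fun σ z => ⨆ i, ∑ j, ((σ j : ℤ) : ℝ) * ℓ i (z j)
    with hA
  have hAm : ∀ σ, Measurable (A σ) := fun σ => h.measurable_iSup _ _
  have hAi : ∀ σ, Integrable (A σ) pm := fun σ =>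
    Integrable.of_bound (hAm σ).aestronglyMeasurable (m * C)
      (ae_of_all _ fun z => h.abs_ciSup_sign_le σ z)
  have hbdd : ∀ (σ : Fin m → ℤˣ) (z : Fin m → Z),
      BddAbove (Set.range fun i => ∑ j, ((σ j : ℤ) : ℝ) * ℓ i (z j)) := fun σ z =>
    bddAbove_range_sum_sign_mul (fun i j => h.abs_le i _) σ
  -- Exchanging the `j`-th pair whenever `σ j = -1` preserves the joint law and turns the ghost
  -- difference into a signed one, whose supremum splits between the two samples.
  have key : ∀ σ : Fin m → ℤˣ, ∫ z, ∫ z', ghostSup ℓ z z' ∂pm ∂pm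
      ≤ (∫ z, A σ z ∂pm) + ∫ z, A (-σ) z ∂pm := by
    intro σ
    set τ : Fin m → Z × Z → Z × Z := fun j => if σ j = 1 then id else Prod.swap with hτ
    have hT : MeasurePreserving (fun (w : Fin m → Z × Z) j => τ j (w j)) W W := by
      refine measurePreserving_pi _ _ fun j => ?_
      by_cases hj : σ j = 1
      · simpa [hτ, hj] using MeasurePreserving.id _
      · simpa [hτ, hj] using Measure.measurePreserving_swap
    rw [← integral_prod _ hG, ← (harr.comp hT).map_eq,
      integral_map (harr.comp hT).measurable.aemeasurable
        h.measurable_ghostSup.aestronglyMeasurable]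
    have e1 : ∫ z, A σ z ∂pm = ∫ w : Fin m → Z × Z, A σ (fun j => (w j).2) ∂W := by
      rw [← hsnd.map_eq, integral_map hsnd.measurable.aemeasurable (hAm σ).aestronglyMeasurable]
    have e2 : ∫ z, A (-σ) z ∂pm = ∫ w : Fin m → Z × Z, A (-σ) (fun j => (w j).1) ∂W := by
      rw [← hfst.map_eq, integral_map hfst.measurable.aemeasurable (hAm _).aestronglyMeasurable]
    have i1 : Integrable (fun w : Fin m → Z × Z => A σ (fun j => (w j).2)) W :=
      hsnd.integrable_comp_of_integrable (hAi σ)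
    have i2 : Integrable (fun w : Fin m → Z × Z => A (-σ) (fun j => (w j).1)) W :=
      hfst.integrable_comp_of_integrable (hAi (-σ))
    rw [e1, e2, ← integral_add i1 i2]
    refine integral_mono ((harr.comp hT).integrable_comp_of_integrable hG) (i1.add i2) fun w => ?_
    refine ciSup_le fun i => ?_
    refine le_trans (le_of_eq ?_) (add_le_add (le_ciSup (hbdd σ fun j => (w j).2) i)
      (le_ciSup (hbdd (-σ) fun j => (w j).1) i))
    rw [← Finset.sum_add_distrib]
    refine Finset.sum_congr rfl fun j _ => ?_
    rcases Int.units_eq_one_or (σ j) with hj | hj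
    · simp [hτ, hj]; ring
    · have : ¬ ((-1 : ℤˣ) = 1) := by decide
      simp [hτ, hj, this]; ring
  have hsum := Finset.sum_le_sum fun σ (_ : σ ∈ (Finset.univ : Finset (Fin m → ℤˣ))) => key σ
  rw [Finset.sum_const, nsmul_eq_mul, card_signs, Finset.sum_add_distrib] at hsum
  -- Summed over all signs, the `σ` and `-σ` contributions coincide, which gives the factor 2.
  have hneg := Equiv.sum_comp (Equiv.neg (Fin m → ℤˣ)) fun σ => ∫ z, A σ z ∂pm
  simp only [Equiv.neg_apply] at hneg
  have hR : ∫ z : Fin m → Z, rademacherSum (fun i j => ℓ i (z j)) ∂pm = ∑ σ, ∫ z, A σ z ∂pm :=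
    integral_finsetSum _ fun σ _ => hAi σ
  rw [hR]
  linarith

/-- Uniform deviation bound in terms of the empirical Rademacher complexity, on a measurable set
of samples of probability at least `1 - δ`. -/
theorem exists_uniform_deviation (h : IsBoundedMeasurableFamily ℓ C B) (hm : 0 < m) (hB : 0 < B)
    {δ : ℝ} (hδ : 0 < δ) (hδ1 : δ ≤ 1) :
    ∃ A : Set (Fin m → Z), MeasurableSet A ∧ 1 - δ ≤ (Measure.pi fun _ => P).real A ∧
      ∀ z ∈ A, ∀ i, ∫ t, ℓ i t ∂P ≤ (1 / (m : ℝ)) * ∑ j, ℓ i (z j)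
        + 2 * ((1 / (m : ℝ)) * ((1 / 2 ^ m) * rademacherSum fun i j => ℓ i (z j)))
        + 3 * B * √(Real.log (1 / δ) / (2 * m)) := by
  have hm' : (0 : ℝ) < m := by exact_mod_cast hm
  have h2m : (0 : ℝ) < 2 ^ m := by positivity
  set pm : Measure (Fin m → Z) := Measure.pi fun _ => P with hpm
  set Ψ : (Fin m → Z) → ℝ := fun z => ∫ z', ghostSup ℓ z z' ∂pm with hΨ
  set R : (Fin m → Z) → ℝ := fun z => (1 / 2 ^ m) * rademacherSum fun i j => ℓ i (z j) with hR
  -- Concentrating the combination avoids a second tail event for the empirical complexity: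
  -- differences are at most `B + 2B`, and symmetrization makes the mean nonpositive.
  set H : (Fin m → Z) → ℝ := fun z => Ψ z - 2 * R z with hH
  have hΨm : Measurable Ψ := h.measurable_ghostSup.stronglyMeasurable.integral_prod_right'.measurable
  have hRm : Measurable R := h.measurable_rademacherSum.const_mul _
  have hHm : Measurable H := hΨm.sub (hRm.const_mul 2)
  have hΨb : ∀ z, |Ψ z| ≤ m * B := fun z => by
    have := norm_integral_le_of_norm_le_const (μ := pm) (f := ghostSup ℓ z) (C := m * B)
      (ae_of_all _ fun z' => h.abs_ghostSup_le z z')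
    simpa using this
  have hRb : ∀ z, |R z| ≤ m * C := fun z => by
    rw [hR]; simp only
    rw [abs_mul, abs_of_nonneg (by positivity), one_div, inv_mul_le_iff₀ h2m]
    exact h.abs_rademacherSum_le z
  have hHb : ∀ z, |H z| ≤ m * B + 2 * (m * C) := fun z => by
    refine (abs_sub _ _).trans (add_le_add (hΨb z) ?_)
    rw [abs_mul, abs_two]
    exact mul_le_mul_of_nonneg_left (hRb z) zero_le_two
  have hHc : ∀ z k a, |H z - H (Function.update z k a)| ≤ 3 * B := by
    intro z k a
    have h1 : |Ψ z - Ψ (Function.update z k a)| ≤ B := by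
      rw [hΨ]; simp only
      rw [← integral_sub (h.integrable_ghostSup_left P _) (h.integrable_ghostSup_left P _)]
      have := norm_integral_le_of_norm_le_const (μ := pm)
        (f := fun z' => ghostSup ℓ z z' - ghostSup ℓ (Function.update z k a) z') (C := B)
        (ae_of_all _ fun z' => h.abs_ghostSup_sub_update_le z z' k a)
      simpa using this
    have h2 : |R z - R (Function.update z k a)| ≤ B := by
      rw [hR]; simp only
      rw [← mul_sub, abs_mul, abs_of_nonneg (by positivity), one_div, inv_mul_le_iff₀ h2m]
      exact h.abs_rademacherSum_sub_update_le z k a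
    rw [_root_.abs_le] at h1 h2 ⊢
    constructor <;> simp only [hH] <;> linarith [h1.1, h1.2, h2.1, h2.2]
  have hEH : ∫ z, H z ∂pm ≤ 0 := by
    have iΨ : Integrable Ψ pm := Integrable.of_bound hΨm.aestronglyMeasurable _ (ae_of_all _ hΨb)
    have iR : Integrable R pm := Integrable.of_bound hRm.aestronglyMeasurable _ (ae_of_all _ hRb)
    have h1 := h.integral_ghostSup_le (m := m) P
    rw [← hpm] at h1
    rw [hH]; simp only
    rw [integral_sub iΨ (iR.const_mul 2), integral_const_mul, hR]
    simp only
    rw [integral_const_mul, sub_nonpos]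
    refine le_of_mul_le_mul_left (h1.trans_eq ?_) h2m
    field_simp
  have hlog : 0 ≤ Real.log (1 / δ) := Real.log_nonneg (by rw [le_div_iff₀ hδ]; linarith)
  -- Chosen so that the sub-Gaussian tail with proxy `m * (3B / 2)²` equals `δ` exactly; the factor
  -- `m` appears because the sums are not normalized.
  set ε := m * (3 * B * √(Real.log (1 / δ) / (2 * m))) with hε
  have hε0 : 0 ≤ ε := by positivity
  have htail := (hasSubgaussianMGF_of_bounded_differences P m H hHm hHb hHc).measure_ge_le hε0
  have hexp : Real.exp (-ε ^ 2 / (2 * ((m * (‖3 * B‖₊ / 2) ^ 2 : NNReal) : ℝ))) = δ := by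
    have h1 : ε ^ 2 = m * (9 * B ^ 2 * Real.log (1 / δ) / 2) := by
      rw [hε, mul_pow, mul_pow, Real.sq_sqrt (by positivity)]
      field_simp
      ring
    have h2 : ((m * (‖3 * B‖₊ / 2) ^ 2 : NNReal) : ℝ) = m * (9 * B ^ 2 / 4) := by
      push_cast
      rw [Real.norm_of_nonneg (by positivity)]
      ring
    have h3 : -ε ^ 2 / (2 * ((m * (‖3 * B‖₊ / 2) ^ 2 : NNReal) : ℝ)) = -Real.log (1 / δ) := by
      rw [h2, h1]
      field_simp
      ring
    rw [h3, one_div, Real.log_inv, neg_neg, Real.exp_log hδ]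
  rw [hexp] at htail
  set bad : Set (Fin m → Z) := {z | ε ≤ H z - ∫ w, H w ∂pm} with hbad
  have hbadm : MeasurableSet bad := measurableSet_le measurable_const (hHm.sub_const _)
  refine ⟨badᶜ, hbadm.compl, ?_, fun z hz i => ?_⟩
  · rw [probReal_compl_eq_one_sub hbadm]
    linarith
  · have h1 : H z < ε := by
      have : ¬ ε ≤ H z - ∫ w, H w ∂pm := hz
      linarith
    have h2 := h.sum_integral_sub_le P z i
    rw [Finset.sum_sub_distrib, Finset.sum_const, nsmul_eq_mul, Finset.card_univ,
      Fintype.card_fin] at h2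
    have h3 : m * ∫ t, ℓ i t ∂P ≤ ∑ j, ℓ i (z j) + 2 * R z + ε := by
      have : H z = Ψ z - 2 * R z := rfl
      have : Ψ z = ∫ z', ghostSup ℓ z z' ∂pm := rfl
      linarith
    refine le_of_mul_le_mul_left (h3.trans_eq ?_) hm'
    rw [hε, hR]
    field_simp

/-- The uniform deviation bound for an i.i.d. sample. -/
theorem exists_uniform_deviation_of_iIndepFun (h : IsBoundedMeasurableFamily ℓ C B) (hm : 0 < m)
    (hB : 0 < B) {Ω : Type*} [MeasurableSpace Ω] {μ : Measure Ω} [IsProbabilityMeasure μ]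
    {S : Fin m → Ω → Z} (hS : ∀ j, Measurable (S j)) (hind : iIndepFun S μ)
    (hlaw : ∀ j, μ.map (S j) = P) {δ : ℝ} (hδ : 0 < δ) (hδ1 : δ ≤ 1) :
    ∃ A : Set Ω, MeasurableSet A ∧ 1 - δ ≤ μ.real A ∧
      ∀ ω ∈ A, ∀ i, ∫ t, ℓ i t ∂P ≤ (1 / (m : ℝ)) * ∑ j, ℓ i (S j ω)
        + 2 * ((1 / (m : ℝ)) * ((1 / 2 ^ m) * rademacherSum fun i j => ℓ i (S j ω)))
        + 3 * B * √(Real.log (1 / δ) / (2 * m)) := by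
  obtain ⟨A, hA, hPA, hdev⟩ := h.exists_uniform_deviation P hm hB hδ hδ1
  have hSm : Measurable fun ω j => S j ω := measurable_pi_lambda _ hS
  refine ⟨(fun ω j => S j ω) ⁻¹' A, hSm hA, ?_, fun ω hω i => hdev _ hω i⟩
  have hmap := (iIndepFun_iff_map_fun_eq_pi_map fun j => (hS j).aemeasurable).1 hind
  simp only [hlaw] at hmap
  rwa [← map_measureReal_apply hSm hA, hmap]

end IsBoundedMeasurableFamily

/-! ### The ramp loss. -/

section Ramp

variable {ρ : ℝ}

/-- The clamped form makes the bounds, monotonicity, continuity and Lipschitz constant immediate. -/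
theorem rampLoss_eq (hρ : 0 < ρ) (x : ℝ) : rampLoss ρ x = max 0 (min 1 (1 - x / ρ)) := by
  unfold rampLoss
  split_ifs with h1 h2
  · have : 1 ≤ x / ρ := (one_le_div hρ).2 h1
    rw [max_eq_left]
    exact (min_le_right _ _).trans (by linarith)
  · have h3 : x / ρ ≤ 1 := (div_le_one hρ).2 (not_le.1 h1).le
    have h4 : 0 < x / ρ := div_pos h2 hρ
    rw [min_eq_right (by linarith), max_eq_right (by linarith)]
  · have : x / ρ ≤ 0 := div_nonpos_of_nonpos_of_nonneg (not_lt.1 h2) hρ.le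
    rw [min_eq_left (by linarith), max_eq_right zero_le_one]

theorem rampLoss_nonneg (hρ : 0 < ρ) (x : ℝ) : 0 ≤ rampLoss ρ x := by
  rw [rampLoss_eq hρ]; exact le_max_left _ _

theorem rampLoss_le_one (hρ : 0 < ρ) (x : ℝ) : rampLoss ρ x ≤ 1 := by
  rw [rampLoss_eq hρ]; exact max_le zero_le_one (min_le_left _ _)

theorem rampLoss_of_nonpos (hρ : 0 < ρ) {x : ℝ} (hx : x ≤ 0) : rampLoss ρ x = 1 := by
  rw [rampLoss, if_neg (by linarith), if_neg (by linarith)]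

theorem rampLoss_antitone (hρ : 0 < ρ) : Antitone (rampLoss ρ) := fun x y h => by
  rw [rampLoss_eq hρ, rampLoss_eq hρ]
  gcongr

theorem continuous_rampLoss (hρ : 0 < ρ) : Continuous (rampLoss ρ) := by
  rw [show rampLoss ρ = _ from funext (rampLoss_eq hρ)]
  fun_prop

theorem abs_rampLoss_sub_le (hρ : 0 < ρ) (x y : ℝ) :
    |rampLoss ρ x - rampLoss ρ y| ≤ 1 / ρ * |x - y| := by
  rw [rampLoss_eq hρ, rampLoss_eq hρ]
  have h1 := abs_max_sub_max_le_max 0 (min 1 (1 - x / ρ)) 0 (min 1 (1 - y / ρ))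
  have h2 := abs_min_sub_min_le_max 1 (1 - x / ρ) 1 (1 - y / ρ)
  rw [sub_self, abs_zero, max_eq_right (abs_nonneg (_ : ℝ))] at h1 h2
  refine (h1.trans h2).trans_eq ?_
  rw [show 1 - x / ρ - (1 - y / ρ) = -(1 / ρ * (x - y)) by ring, abs_neg, abs_mul,
    abs_of_pos (one_div_pos.2 hρ)]

theorem abs_rampLoss_sub_le_one (hρ : 0 < ρ) (x y : ℝ) :
    |rampLoss ρ x - rampLoss ρ y| ≤ 1 := by
  rw [abs_le]
  constructor <;> linarith [rampLoss_nonneg hρ x, rampLoss_nonneg hρ y, rampLoss_le_one hρ x,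
    rampLoss_le_one hρ y]

end Ramp

/-! ### Pointwise inequalities between score vectors. -/

section Margin

variable {K : ℕ} {ρ : ℝ}

theorem sum_ite_eq_add_mul (i : Fin K) (a b : ℝ) :
    ∑ j, (if i = j then a else b) = a + (K - 1) * b := by
  have : ∀ j, (if i = j then a else b) = b + if i = j then a - b else 0 := by
    intro j; split_ifs <;> ring
  simp only [this, Finset.sum_add_distrib, Finset.sum_ite_eq]
  simp
  ring

/-- Row `i` of a violation matrix has one diagonal entry `Φ_ρ(v_i)` and `K - 1` equal entries
`Φ_ρ(-v_i)`. -/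
theorem entrywiseL1_violationMatrix_sub (v w : Fin K → ℝ) :
    entrywiseL1 (violationMatrix ρ v - violationMatrix ρ w)
      = ∑ i, (|rampLoss ρ (v i) - rampLoss ρ (w i)|
          + (K - 1) * |rampLoss ρ (-v i) - rampLoss ρ (-w i)|) := by
  refine Finset.sum_congr rfl fun i _ => ?_
  rw [← sum_ite_eq_add_mul i]
  refine Finset.sum_congr rfl fun j _ => ?_
  simp only [violationMatrix, absMargin, Matrix.sub_apply, Matrix.of_apply]
  split_ifs <;> rfl

theorem add_le_sum_of_ne {ι : Type*} [Fintype ι] [DecidableEq ι] {f : ι → ℝ} (hf : ∀ i, 0 ≤ f i)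
    {i j : ι} (hij : i ≠ j) : f i + f j ≤ ∑ k, f k := by
  rw [← Finset.sum_pair hij]
  exact Finset.sum_le_sum_of_subset_of_nonneg (Finset.subset_univ _) fun k _ _ => hf k

theorem one_le_card_of_label (y : Fin K) : (1 : ℝ) ≤ K := by
  exact_mod_cast y.pos

/-- The margin loss `∑_k Φ_ρ(μ_k(v, y))` of a score vector. -/
noncomputable def marginLoss (ρ : ℝ) (v : Fin K → ℝ) (y : Fin K) : ℝ :=
  ∑ k, rampLoss ρ (absMargin v y k)

/-- The scaled matrix distance `‖M(v) - M(w)‖₁ / K` of two score vectors. -/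
noncomputable def scoringDistance (ρ : ℝ) (v w : Fin K → ℝ) : ℝ :=
  1 / (K : ℝ) * entrywiseL1 (violationMatrix ρ v - violationMatrix ρ w)

theorem entrywiseL1_nonneg (A : Matrix (Fin K) (Fin K) ℝ) : 0 ≤ entrywiseL1 A :=
  Finset.sum_nonneg fun _ _ => Finset.sum_nonneg fun _ _ => abs_nonneg _

theorem scoringDistance_nonneg (v w : Fin K → ℝ) : 0 ≤ scoringDistance ρ v w :=
  mul_nonneg (by positivity) (entrywiseL1_nonneg _)

theorem marginLoss_nonneg (hρ : 0 < ρ) (v : Fin K → ℝ) (y : Fin K) : 0 ≤ marginLoss ρ v y :=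
  Finset.sum_nonneg fun _ _ => rampLoss_nonneg hρ _

theorem marginLoss_le (hρ : 0 < ρ) (v : Fin K → ℝ) (y : Fin K) : marginLoss ρ v y ≤ K :=
  (Finset.sum_le_card_nsmul _ _ 1 fun _ _ => rampLoss_le_one hρ _).trans_eq (by simp)

theorem scoringDistance_le (hρ : 0 < ρ) (v w : Fin K → ℝ) : scoringDistance ρ v w ≤ K := by
  rcases K.eq_zero_or_pos with rfl | hK
  · simp [scoringDistance]
  have hK' : (0 : ℝ) < K := by exact_mod_cast hK
  have : entrywiseL1 (violationMatrix ρ v - violationMatrix ρ w) ≤ K * K := by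
    refine (Finset.sum_le_card_nsmul _ _ (K : ℝ) fun i _ => ?_).trans_eq (by simp)
    refine (Finset.sum_le_card_nsmul _ _ (1 : ℝ) fun j _ => ?_).trans_eq (by simp)
    exact abs_rampLoss_sub_le_one hρ _ _
  rwa [scoringDistance, one_div, inv_mul_le_iff₀ hK']

/-- Each of the `K` entries in row `i` is bounded by the same quantity, the `i`-th terms of the two
margin losses at `y`; the factor `1 / K` cancels this multiplicity. -/
theorem scoringDistance_le_marginLoss_add (hρ : 0 < ρ) (v w : Fin K → ℝ) (y : Fin K) :
    scoringDistance ρ v w ≤ marginLoss ρ v y + marginLoss ρ w y := by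
  have hK := one_le_card_of_label y
  rw [scoringDistance, one_div, inv_mul_le_iff₀ (by linarith), entrywiseL1_violationMatrix_sub,
    marginLoss, marginLoss, ← Finset.sum_add_distrib, Finset.mul_sum]
  refine Finset.sum_le_sum fun i _ => ?_
  -- The case `s = -1` is the point: if `a` or `b` is nonnegative, its flipped ramp is 1 and
  -- dominates the difference; if both are negative, both ramps are 1 and the difference vanishes.
  have key : ∀ s a b : ℝ, s = 1 ∨ s = -1 →
      |rampLoss ρ a - rampLoss ρ b| ≤ rampLoss ρ (s * a) + rampLoss ρ (s * b) := by
    intro s a b hs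
    have ha := rampLoss_nonneg hρ a
    have hb := rampLoss_nonneg hρ b
    have ha' := rampLoss_nonneg hρ (-a)
    have hb' := rampLoss_nonneg hρ (-b)
    rcases hs with rfl | rfl
    · rw [one_mul, one_mul, abs_le]
      constructor <;> linarith
    · rw [neg_one_mul, neg_one_mul]
      rcases le_or_gt 0 a with h | h
      · rw [rampLoss_of_nonpos hρ (neg_nonpos.2 h)]
        linarith [abs_rampLoss_sub_le_one hρ a b]
      · rcases le_or_gt 0 b with h' | h'
        · rw [rampLoss_of_nonpos hρ (neg_nonpos.2 h')]
          linarith [abs_rampLoss_sub_le_one hρ a b]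
        · rw [rampLoss_of_nonpos hρ h.le, rampLoss_of_nonpos hρ h'.le, sub_self, abs_zero]
          linarith
  have h1 : |rampLoss ρ (v i) - rampLoss ρ (w i)|
      ≤ rampLoss ρ (absMargin v y i) + rampLoss ρ (absMargin w y i) := by
    unfold absMargin
    split_ifs
    · simpa using key 1 (v i) (w i) (Or.inl rfl)
    · simpa using key (-1) (v i) (w i) (Or.inr rfl)
  have h2 : |rampLoss ρ (-v i) - rampLoss ρ (-w i)|
      ≤ rampLoss ρ (absMargin v y i) + rampLoss ρ (absMargin w y i) := by
    unfold absMargin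
    split_ifs
    · simpa using key (-1) (-v i) (-w i) (Or.inr rfl)
    · simpa using key 1 (-v i) (-w i) (Or.inl rfl)
  nlinarith [mul_le_mul_of_nonneg_left h2 (sub_nonneg.2 hK)]

/-- If some margin of `w` at `y` is nonpositive, the margin loss alone is at least 1. Otherwise `w`
is negative at `h` and positive at `y`, while `v h ≥ 0`, so rows `h` and `y` of the matrices differ
enough to supply whatever the margin loss lacks. -/
theorem ite_ne_le_scoringDistance_add (hρ : 0 < ρ) {v w : Fin K → ℝ} (hv : ∑ k, v k = 0)
    {h : Fin K} (hh : ∀ k, v k ≤ v h) (y : Fin K) :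
    (if h ≠ y then (1 : ℝ) else 0) ≤ scoringDistance ρ v w + marginLoss ρ w y := by
  have hK := one_le_card_of_label y
  have hd := scoringDistance_nonneg (ρ := ρ) v w
  have hl := marginLoss_nonneg hρ w y
  split_ifs with hne
  swap
  · linarith
  by_cases hbad : ∃ k, absMargin w y k ≤ 0
  · obtain ⟨k, hk⟩ := hbad
    have h1 : rampLoss ρ (absMargin w y k) ≤ marginLoss ρ w y :=
      Finset.single_le_sum (f := fun k => rampLoss ρ (absMargin w y k))
        (fun k _ => rampLoss_nonneg hρ _) (Finset.mem_univ k)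
    rw [rampLoss_of_nonpos hρ hk] at h1
    linarith
  push Not at hbad
  have hwy : 0 < w y := by simpa [absMargin] using hbad y
  have hwh : w h < 0 := by simpa [absMargin, hne] using hbad h
  -- The largest of scores with sum zero cannot be negative.
  have hvh : 0 ≤ v h := by
    by_contra hlt
    have : ∑ k, v k < 0 := Finset.sum_neg (fun k _ => (hh k).trans_lt (not_le.1 hlt)) ⟨y, by simp⟩
    linarith
  have hml : rampLoss ρ (-w h) + rampLoss ρ (w y) ≤ marginLoss ρ w y := by
    have := add_le_sum_of_ne (f := fun k => rampLoss ρ (absMargin w y k))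
      (fun k => rampLoss_nonneg hρ _) hne
    simpa [absMargin, hne, marginLoss] using this
  have hrows := add_le_sum_of_ne (f := fun i => |rampLoss ρ (v i) - rampLoss ρ (w i)|
      + (K - 1) * |rampLoss ρ (-v i) - rampLoss ρ (-w i)|)
    (fun i => add_nonneg (abs_nonneg _) (mul_nonneg (by linarith) (abs_nonneg _))) hne
  rw [← entrywiseL1_violationMatrix_sub] at hrows
  have ha := rampLoss_nonneg hρ (-w h)
  have hb := rampLoss_nonneg hρ (w y)
  have hrow_h : (1 - rampLoss ρ (v h)) + (K - 1) * (1 - rampLoss ρ (-w h))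
      ≤ |rampLoss ρ (v h) - rampLoss ρ (w h)|
        + (K - 1) * |rampLoss ρ (-v h) - rampLoss ρ (-w h)| := by
    rw [rampLoss_of_nonpos hρ hwh.le, rampLoss_of_nonpos hρ (neg_nonpos.2 hvh)]
    refine add_le_add ?_ (mul_le_mul_of_nonneg_left (le_abs_self _) (by linarith))
    rw [abs_sub_comm]
    exact le_abs_self _
  have hrow_y : rampLoss ρ (v y) - rampLoss ρ (w y)
      ≤ |rampLoss ρ (v y) - rampLoss ρ (w y)|
        + (K - 1) * |rampLoss ρ (-v y) - rampLoss ρ (-w y)| :=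
    (le_abs_self _).trans
      (le_add_of_nonneg_right (mul_nonneg (by linarith) (abs_nonneg _)))
  -- Since `v y ≤ v h`, the `-Φ_ρ(v_h)` from row `h` is compensated by the `Φ_ρ(v_y)` from row `y`.
  have hanti := rampLoss_antitone hρ (hh y)
  have hent : (K : ℝ) - (K - 1) * rampLoss ρ (-w h) - rampLoss ρ (w y)
      ≤ entrywiseL1 (violationMatrix ρ v - violationMatrix ρ w) := by
    linarith
  have hdist : entrywiseL1 (violationMatrix ρ v - violationMatrix ρ w)
      = K * scoringDistance ρ v w := by
    rw [scoringDistance]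
    field_simp
  have : (K : ℝ) * 1 ≤ K * (scoringDistance ρ v w + marginLoss ρ w y) := by
    nlinarith [mul_le_mul_of_nonneg_left hml (by linarith : (0 : ℝ) ≤ K)]
  exact le_of_mul_le_mul_left this (by linarith)

theorem continuous_marginLoss (hρ : 0 < ρ) (y : Fin K) :
    Continuous fun v : Fin K → ℝ => marginLoss ρ v y := by
  refine continuous_finsetSum _ fun k _ => (continuous_rampLoss hρ).comp ?_
  unfold absMargin
  split_ifs <;> fun_prop

theorem continuous_scoringDistance (hρ : 0 < ρ) :
    Continuous fun p : (Fin K → ℝ) × (Fin K → ℝ) => scoringDistance ρ p.1 p.2 := by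
  have hc := continuous_rampLoss hρ
  simp only [scoringDistance, entrywiseL1_violationMatrix_sub]
  fun_prop

end Margin

attribute [irreducible] marginLoss scoringDistance

/-! ### Measurability of suprema over `F` and `F × F`. -/

section Measurability

variable {X : Type*} [MeasurableSpace X] {K : ℕ} {F : Set (X → Fin K → ℝ)}

theorem IsMeasurableClass.measurable_iSup (hF : IsMeasurableClass F) [Nonempty F] {n : ℕ}
    {φ : (Fin n → Fin K → ℝ) → ℝ} (hφ : Continuous φ) {C : ℝ} (hC : ∀ v, |φ v| ≤ C) :
    Measurable fun x : Fin n → X => ⨆ f : F, φ fun i => f.1 (x i) := by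
  refine measurable_of_Ioi fun c => ?_
  convert hF.measurableSet_exists n (φ ⁻¹' Set.Ioi c) (isOpen_Ioi.preimage hφ) using 1
  ext x
  simp only [Set.mem_preimage, Set.mem_Ioi, Set.mem_ofPred_eq]
  rw [lt_ciSup_iff (bddAbove_range_of_abs_le fun f => hC _)]
  simp

/-- An open set in the product is a countable union of open rectangles, and since the two members of
`F` are chosen independently, hitting a rectangle is the intersection of two events covered by `hF`.
-/
theorem IsMeasurableClass.measurable_iSup_prod (hF : IsMeasurableClass F) [Nonempty F] {n : ℕ}
    {φ : (Fin n → Fin K → ℝ) × (Fin n → Fin K → ℝ) → ℝ} (hφ : Continuous φ) {C : ℝ}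
    (hC : ∀ v, |φ v| ≤ C) :
    Measurable fun x : Fin n → X =>
      ⨆ p : F × F, φ (fun i => p.1.1 (x i), fun i => p.2.1 (x i)) := by
  refine measurable_of_Ioi fun c => ?_
  set B := TopologicalSpace.countableBasis (Fin n → Fin K → ℝ) with hB
  have hBb := TopologicalSpace.isBasis_countableBasis (Fin n → Fin K → ℝ)
  set I : Set (Set (Fin n → Fin K → ℝ) × Set (Fin n → Fin K → ℝ)) :=
    {s | s.1 ∈ B ∧ s.2 ∈ B ∧ s.1 ×ˢ s.2 ⊆ φ ⁻¹' Set.Ioi c} with hI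
  have hIc : I.Countable :=
    ((TopologicalSpace.countable_countableBasis (Fin n → Fin K → ℝ)).prod
      (TopologicalSpace.countable_countableBasis (Fin n → Fin K → ℝ))).mono
      fun s hs => Set.mk_mem_prod hs.1 hs.2.1
  have hset : (fun x : Fin n → X =>
      ⨆ p : F × F, φ (fun i => p.1.1 (x i), fun i => p.2.1 (x i))) ⁻¹' Set.Ioi c
      = ⋃ s ∈ I, {x : Fin n → X | ∃ f ∈ F, (fun i => f (x i)) ∈ s.1}
          ∩ {x : Fin n → X | ∃ f ∈ F, (fun i => f (x i)) ∈ s.2} := by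
    ext x
    simp only [Set.mem_preimage, Set.mem_Ioi, Set.mem_iUnion, Set.mem_inter_iff, Set.mem_ofPred_eq]
    rw [lt_ciSup_iff (bddAbove_range_of_abs_le fun f => hC _)]
    constructor
    · rintro ⟨⟨⟨f, hf⟩, ⟨g, hg⟩⟩, hlt⟩
      have hlt' : ((fun i => f (x i), fun i => g (x i)) :
          (Fin n → Fin K → ℝ) × (Fin n → Fin K → ℝ)) ∈ φ ⁻¹' Set.Ioi c := hlt
      obtain ⟨_, ⟨s, hs, t, ht, rfl⟩, hmem, hsub⟩ :=
        (hBb.prod hBb).exists_subset_of_mem_open hlt' (isOpen_Ioi.preimage hφ)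
      exact ⟨(s, t), ⟨hs, ht, hsub⟩, ⟨f, hf, hmem.1⟩, ⟨g, hg, hmem.2⟩⟩
    · rintro ⟨s, hs, ⟨f, hf, hfs⟩, ⟨g, hg, hgs⟩⟩
      exact ⟨(⟨f, hf⟩, ⟨g, hg⟩), hs.2.2 (Set.mk_mem_prod hfs hgs)⟩
  rw [hset]
  exact MeasurableSet.biUnion hIc fun s hs =>
    (hF.measurableSet_exists n _ (hBb.isOpen hs.1)).inter
      (hF.measurableSet_exists n _ (hBb.isOpen hs.2.1))

theorem abs_sum_mul_le {n : ℕ} (a : Fin n → ℝ) {b : Fin n → ℝ} {C : ℝ} (hb : ∀ j, |b j| ≤ C) :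
    |∑ j, a j * b j| ≤ (∑ j, |a j|) * C := by
  refine (Finset.abs_sum_le_sum_abs _ _).trans ?_
  rw [Finset.sum_mul]
  refine Finset.sum_le_sum fun j _ => ?_
  rw [abs_mul]
  exact mul_le_mul_of_nonneg_left (hb j) (abs_nonneg _)

variable {ρ : ℝ}

theorem abs_sub_le_of_mem_Icc {a b K : ℝ} (ha : 0 ≤ a) (ha' : a ≤ K) (hb : 0 ≤ b) (hb' : b ≤ K) :
    |a - b| ≤ K := by
  rw [abs_le]; constructor <;> linarith

theorem isBoundedMeasurableFamily_marginLoss (hF : IsMeasurableClass F) [Nonempty F]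
    (hρ : 0 < ρ) :
    IsBoundedMeasurableFamily (fun (f : F) (z : X × Fin K) => marginLoss ρ (f.1 z.1) z.2) K K where
  measurable f := by
    refine measurable_from_prod_countable_left fun y => ?_
    have h := (continuous_marginLoss hρ y).measurable
    exact h.comp (hF.measurable f.1 f.2)
  abs_le f z := by
    rw [abs_of_nonneg (marginLoss_nonneg hρ _ _)]
    exact marginLoss_le hρ _ _
  abs_sub_le f z z' := abs_sub_le_of_mem_Icc (marginLoss_nonneg hρ _ _) (marginLoss_le hρ _ _)
    (marginLoss_nonneg hρ _ _) (marginLoss_le hρ _ _)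
  measurable_iSup n a := by
    have h : Measurable fun p : (Fin n → X) × (Fin n → Fin K) =>
        ⨆ f : F, ∑ j, a j * marginLoss ρ (f.1 (p.1 j)) (p.2 j) := by
      -- There are finitely many label vectors, so the labels can be fixed.
      refine measurable_from_prod_countable_left fun y => ?_
      refine hF.measurable_iSup (φ := fun v => ∑ j, a j * marginLoss ρ (v j) (y j))
        (C := (∑ j, |a j|) * K) ?_ fun v => abs_sum_mul_le a fun j => ?_
      · exact continuous_finsetSum _ fun j _ =>
          ((continuous_marginLoss hρ (y j)).comp (continuous_apply j)).const_mul (a j)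
      · rw [abs_of_nonneg (marginLoss_nonneg hρ _ _)]
        exact marginLoss_le hρ _ _
    have h' : Measurable fun z : Fin n → X × Fin K =>
        ((fun j => (z j).1, fun j => (z j).2) : (Fin n → X) × (Fin n → Fin K)) := by
      fun_prop
    exact h.comp h'

theorem measurable_scoringDistance (hF : IsMeasurableClass F) (hρ : 0 < ρ) (p : F × F) :
    Measurable fun x => scoringDistance ρ (p.1.1 x) (p.2.1 x) :=
  (continuous_scoringDistance hρ).measurable.comp
    ((hF.measurable p.1.1 p.1.2).prodMk (hF.measurable p.2.1 p.2.2))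

theorem isBoundedMeasurableFamily_scoringDistance (hF : IsMeasurableClass F) [Nonempty F]
    (hρ : 0 < ρ) {s : ℝ} (hs : |s| = 1) :
    IsBoundedMeasurableFamily
      (fun (p : F × F) (x : X) => s * scoringDistance ρ (p.1.1 x) (p.2.1 x)) K K where
  measurable p := (measurable_scoringDistance hF hρ p).const_mul s
  abs_le p x := by
    rw [abs_mul, hs, one_mul, abs_of_nonneg (scoringDistance_nonneg _ _)]
    exact scoringDistance_le hρ _ _
  abs_sub_le p x x' := by
    rw [← mul_sub, abs_mul, hs, one_mul]
    exact abs_sub_le_of_mem_Icc (scoringDistance_nonneg _ _) (scoringDistance_le hρ _ _)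
      (scoringDistance_nonneg _ _) (scoringDistance_le hρ _ _)
  measurable_iSup n a := by
    refine hF.measurable_iSup_prod
      (φ := fun v => ∑ j, a j * (s * scoringDistance ρ (v.1 j) (v.2 j)))
      (C := (∑ j, |a j|) * K) ?_ fun v => abs_sum_mul_le a fun j => ?_
    · refine continuous_finsetSum _ fun j _ => ((Continuous.const_mul ?_ s).const_mul (a j))
      have h := continuous_scoringDistance (K := K) hρ
      exact h.comp (f := fun v : (Fin n → Fin K → ℝ) × (Fin n → Fin K → ℝ) => (v.1 j, v.2 j))
        (by fun_prop)
    · rw [abs_mul, hs, one_mul, abs_of_nonneg (scoringDistance_nonneg _ _)]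
      exact scoringDistance_le hρ _ _

end Measurability

/-! ### Reduction of the composite classes to `Pi1 F`. -/

section RademacherBounds

variable {X : Type*} {K m : ℕ} {F : Set (X → Fin K → ℝ)} {ρ C : ℝ}

/-- At each sample point the term is a `1 / ρ`-Lipschitz function of the single component `f_k`; the
label only decides the sign of its argument, and `s` does not affect the constant. -/
theorem rademacherSum_ramp_component_le {ι : Type*} [Nonempty ι] (hρ : 0 < ρ) {x : Fin m → X}
    (hC : ∀ (g : Pi1 F) j, |g.1 (x j)| ≤ C) {s : ℝ} (hs : |s| = 1) (e : ι → F) (k : Fin K)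
    (y : Fin m → Fin K) :
    rademacherSum (fun i j => s * rampLoss ρ (absMargin ((e i).1 (x j)) (y j) k))
      ≤ 1 / ρ * rademacherSum fun (g : Pi1 F) j => g.1 (x j) := by
  have hρ' : 0 ≤ 1 / ρ := by positivity
  set c : ι → Pi1 F := fun i => ⟨fun x => (e i).1 x k, (e i).1, (e i).2, k, rfl⟩ with hc
  have h1 := rademacherSum_lipschitz_le (L := 1 / ρ) (D := C) hρ'
    (t := fun i j => (c i).1 (x j))
    (φ := fun j u => s * rampLoss ρ (if k = y j then u else -u))
    (fun j a b => by
      rw [← mul_sub, abs_mul, hs, one_mul]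
      split_ifs
      · exact abs_rampLoss_sub_le hρ a b
      · refine (abs_rampLoss_sub_le hρ (-a) (-b)).trans_eq ?_
        rw [neg_sub_neg, abs_sub_comm])
    fun i j => hC _ _
  refine LE.le.trans (le_of_eq ?_) (h1.trans (mul_le_mul_of_nonneg_left
    (rademacherSum_comp_le hC c) hρ'))
  rfl

theorem rademacherSum_marginLoss_le [Nonempty F] (hρ : 0 < ρ) {x : Fin m → X}
    (hC : ∀ (g : Pi1 F) j, |g.1 (x j)| ≤ C) (y : Fin m → Fin K) :
    rademacherSum (fun (f : F) j => marginLoss ρ (f.1 (x j)) (y j))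
      ≤ K / ρ * rademacherSum fun (g : Pi1 F) j => g.1 (x j) := by
  simp only [marginLoss]
  refine (rademacherSum_sum_le Finset.univ (C := 1)
    (t := fun k (f : F) j => rampLoss ρ (absMargin (f.1 (x j)) (y j) k)) fun k f j => ?_).trans ?_
  · rw [abs_of_nonneg (rampLoss_nonneg hρ _)]
    exact rampLoss_le_one hρ _
  · refine (Finset.sum_le_card_nsmul _ _
      (1 / ρ * rademacherSum fun (g : Pi1 F) j => g.1 (x j)) fun k _ => ?_).trans_eq
      (by rw [Finset.card_univ, Fintype.card_fin, nsmul_eq_mul, ← mul_assoc, mul_one_div])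
    simpa using rademacherSum_ramp_component_le hρ hC abs_one (id : F → F) k y

/-- Contraction is used twice per matrix entry: first for the absolute value, scaled by `s / K`,
then for each of the two ramps. The count is `K² * (1 / K) * (2 / ρ)`. -/
theorem rademacherSum_scoringDistance_le [Nonempty F] (hρ : 0 < ρ) {x : Fin m → X}
    (hC : ∀ (g : Pi1 F) j, |g.1 (x j)| ≤ C) {s : ℝ} (hs : |s| = 1) :
    rademacherSum (fun (p : F × F) j => s * scoringDistance ρ (p.1.1 (x j)) (p.2.1 (x j)))
      ≤ 2 * K / ρ * rademacherSum fun (g : Pi1 F) j => g.1 (x j) := by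
  set R := rademacherSum fun (g : Pi1 F) j => g.1 (x j) with hR
  set a : Fin K × Fin K → F → Fin m → ℝ :=
    fun q f j => rampLoss ρ (absMargin (f.1 (x j)) q.2 q.1) with ha
  have ha1 : ∀ q f j, |a q f j| ≤ 1 := fun q f j => by
    rw [ha]; simp only
    rw [abs_of_nonneg (rampLoss_nonneg hρ _)]
    exact rampLoss_le_one hρ _
  have hd : ∀ q (p : F × F) j, |a q p.1 j - a q p.2 j| ≤ 1 := fun q p j =>
    abs_rampLoss_sub_le_one hρ _ _
  have hsK : |s / K| = 1 / K := by rw [abs_div, hs, Nat.abs_cast]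
  have hexpand : (fun (p : F × F) j => s * scoringDistance ρ (p.1.1 (x j)) (p.2.1 (x j)))
      = fun p j => ∑ q, s / K * |a q p.1 j - a q p.2 j| := by
    funext p j
    rw [Fintype.sum_prod_type]
    simp only [scoringDistance, entrywiseL1, ← Finset.mul_sum, ha]
    rw [← mul_assoc, mul_one_div]
    rfl
  rw [hexpand]
  refine (rademacherSum_sum_le Finset.univ (C := 1 / K)
    (t := fun q (p : F × F) j => s / K * |a q p.1 j - a q p.2 j|) fun q p j => ?_).trans ?_
  · rw [abs_mul, hsK, abs_abs]
    exact mul_le_of_le_one_right (by positivity) (hd q p j)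
  have hterm : ∀ q, rademacherSum (fun (p : F × F) j => s / K * |a q p.1 j - a q p.2 j|)
      ≤ 1 / K * (2 / ρ * R) := by
    intro q
    have h1 := rademacherSum_lipschitz_le (L := 1 / (K : ℝ)) (D := 1) (by positivity)
      (t := fun (p : F × F) j => a q p.1 j - a q p.2 j) (φ := fun _ u => s / K * |u|)
      (fun j u v => by
        rw [← mul_sub, abs_mul, hsK]
        exact mul_le_mul_of_nonneg_left (abs_abs_sub_abs_le_abs_sub u v) (by positivity))
      (hd q)
    refine h1.trans (mul_le_mul_of_nonneg_left ?_ (by positivity))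
    have h2 := rademacherSum_add_le (s := fun (p : F × F) j => 1 * a q p.1 j)
      (t := fun (p : F × F) j => -1 * a q p.2 j) (C := 1) (D := 1)
      (fun p j => by simpa using ha1 q p.1 j) (fun p j => by simpa using ha1 q p.2 j)
    have h3 := rademacherSum_ramp_component_le hρ hC abs_one (Prod.fst : F × F → F) q.1
      (fun _ => q.2)
    have h4 := rademacherSum_ramp_component_le hρ hC (s := -1) (by simp) (Prod.snd : F × F → F)
      q.1 (fun _ => q.2)
    have h5 : (fun (p : F × F) (j : Fin m) => a q p.1 j - a q p.2 j)
        = fun p j => 1 * a q p.1 j + -1 * a q p.2 j := by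
      funext p j; ring
    rw [h5]
    refine h2.trans ((add_le_add h3 h4).trans_eq ?_)
    ring
  refine (Finset.sum_le_card_nsmul _ _ _ fun q _ => hterm q).trans_eq ?_
  rw [Finset.card_univ, Fintype.card_prod, Fintype.card_fin, nsmul_eq_mul]
  rcases K.eq_zero_or_pos with rfl | hK
  · simp
  · have : (K : ℝ) ≠ 0 := by positivity
    push_cast
    field_simp

end RademacherBounds

/-! ### From extended-real to real Rademacher complexity. -/

section ExtendedReal

theorem EReal_sum_ne_bot {α : Type*} (s : Finset α) {f : α → EReal} (hf : ∀ a ∈ s, f a ≠ ⊥) :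
    ∑ a ∈ s, f a ≠ ⊥ :=
  Finset.sum_induction f (· ≠ ⊥) (fun _ _ ha hb => EReal.add_ne_bot_iff.2 ⟨ha, hb⟩)
    EReal.zero_ne_bot hf

/-- The empirical Rademacher complexity is either infinite, or the class is bounded on the sample
and the complexity is the real-valued one. -/
theorem empRademacher_eq_top_or {Z : Type*} {m : ℕ} (hm : 0 < m) (G : Set (Z → ℝ))
    (hG : G.Nonempty) (z : Fin m → Z) :
    empRademacher G z = ⊤ ∨ (∃ C, ∀ (g : G) j, |g.1 (z j)| ≤ C) ∧
      empRademacher G z = ((1 / (m : ℝ) * (1 / 2 ^ m *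
        rademacherSum fun (g : G) j => g.1 (z j)) : ℝ) : EReal) := by
  have : Nonempty G := hG.to_subtype
  have hm' : (0 : ℝ) < 1 / (m : ℝ) := by positivity
  have h2 : (0 : ℝ) < 1 / 2 ^ m := by positivity
  set S : (Fin m → ℤˣ) → EReal :=
    fun σ => ⨆ g ∈ G, ((∑ i, ((σ i : ℤ) : ℝ) * g (z i) : ℝ) : EReal) with hS
  have hle : ∀ σ, ∀ g ∈ G, ((∑ i, ((σ i : ℤ) : ℝ) * g (z i) : ℝ) : EReal) ≤ S σ :=
    fun σ g hg => le_iSup₂ (f := fun (g : Z → ℝ) (_ : g ∈ G) =>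
      ((∑ i, ((σ i : ℤ) : ℝ) * g (z i) : ℝ) : EReal)) g hg
  have hbot : ∀ σ, S σ ≠ ⊥ := by
    intro σ
    obtain ⟨g, hg⟩ := hG
    exact ((EReal.bot_lt_coe _).trans_le (hle σ g hg)).ne'
  by_cases htop : ∃ σ, S σ = ⊤
  · left
    obtain ⟨σ, hσ⟩ := htop
    have hsum : ∑ σ, S σ = ⊤ := by
      rw [← Finset.add_sum_erase _ _ (Finset.mem_univ σ), hσ]
      exact EReal.top_add_of_ne_bot (EReal_sum_ne_bot _ fun τ _ => hbot τ)
    change ((1 / (m : ℝ) : ℝ) : EReal) * (((1 / 2 ^ m : ℝ) : EReal) * ∑ σ, S σ) = ⊤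
    rw [hsum, EReal.coe_mul_top_of_pos h2, EReal.coe_mul_top_of_pos hm']
  · right
    push Not at htop
    have hr : ∀ σ, ∃ r : ℝ, S σ = r := fun σ =>
      ⟨(S σ).toReal, (EReal.coe_toReal (htop σ) (hbot σ)).symm⟩
    choose r hr using hr
    have hgr : ∀ σ, ∀ g : G, ∑ i, ((σ i : ℤ) : ℝ) * g.1 (z i) ≤ r σ := fun σ g => by
      have := hle σ g.1 g.2
      rw [hr] at this
      exact_mod_cast this
    constructor
    · refine ⟨∑ σ, |r σ|, fun g j => ?_⟩
      -- Matching the signs of `g` makes the signed sum equal to the `ℓ¹` norm on the sample, so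
      -- finiteness of all the suprema bounds the class there.
      set σ : Fin m → ℤˣ := fun i => if 0 ≤ g.1 (z i) then 1 else -1 with hσ
      have h1 : ∑ i, ((σ i : ℤ) : ℝ) * g.1 (z i) = ∑ i, |g.1 (z i)| := by
        refine Finset.sum_congr rfl fun i _ => ?_
        simp only [hσ]
        split_ifs with h
        · simp [abs_of_nonneg h]
        · simp [abs_of_neg (not_le.1 h)]
      calc |g.1 (z j)| ≤ ∑ i, |g.1 (z i)| :=
            Finset.single_le_sum (f := fun i => |g.1 (z i)|) (fun i _ => abs_nonneg _)
              (Finset.mem_univ j)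
        _ ≤ r σ := h1 ▸ hgr σ g
        _ ≤ |r σ| := le_abs_self _
        _ ≤ ∑ σ, |r σ| := Finset.single_le_sum (f := fun σ => |r σ|) (fun i _ => abs_nonneg _)
              (Finset.mem_univ σ)
    · have hsup : ∀ σ, S σ = ((⨆ g : G, ∑ i, ((σ i : ℤ) : ℝ) * g.1 (z i) : ℝ) : EReal) := by
        intro σ
        refine le_antisymm (iSup₂_le fun g hg => EReal.coe_le_coe_iff.2 ?_) ?_
        · exact le_ciSup (f := fun g : G => ∑ i, ((σ i : ℤ) : ℝ) * g.1 (z i))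
            ⟨r σ, by rintro _ ⟨g, rfl⟩; exact hgr σ g⟩ ⟨g, hg⟩
        · rw [hr, EReal.coe_le_coe_iff]
          exact ciSup_le (hgr σ)
      change ((1 / (m : ℝ) : ℝ) : EReal) * (((1 / 2 ^ m : ℝ) : EReal) * ∑ σ, S σ) = _
      simp only [hsup, rademacherSum]
      rw [EReal.coe_mul, EReal.coe_mul]
      congr 2
      exact (map_sum (⟨⟨Real.toEReal, EReal.coe_zero⟩, EReal.coe_add⟩ : ℝ →+ EReal) _ _).symm

end ExtendedReal

/-! ### Integrated forms of the pointwise inequalities. -/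

section Risks

variable {X : Type*} [MeasurableSpace X] {K : ℕ} {F : Set (X → Fin K → ℝ)} {ρ : ℝ}

theorem isProbabilityMeasure_empiricalMeasure {Z : Type*} [MeasurableSpace Z] {m : ℕ} (hm : 0 < m)
    (z : Fin m → Z) : IsProbabilityMeasure (empiricalMeasure z) := by
  refine ⟨?_⟩
  simp only [empiricalMeasure, Measure.smul_apply, Measure.finsetSum_apply, measure_univ,
    Finset.sum_const, Finset.card_univ, Fintype.card_fin, smul_eq_mul, nsmul_eq_mul, mul_one]
  exact ENNReal.inv_mul_cancel (by exact_mod_cast hm.ne') (ENNReal.natCast_ne_top m)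

theorem MCSD_eq (D : Measure X) (f g : X → Fin K → ℝ) :
    MCSD ρ D f g = ∫ x, scoringDistance ρ (f x) (g x) ∂D := by
  simp only [MCSD, scoringDistance]
  rw [integral_const_mul]

theorem rampRisk_eq (D : Measure (X × Fin K)) (f : X → Fin K → ℝ) :
    rampRisk ρ D f = ∫ z, marginLoss ρ (f z.1) z.2 ∂D := by
  simp only [rampRisk, marginLoss]

theorem abs_MCSD_le (hρ : 0 < ρ) (D : Measure X) [IsProbabilityMeasure D]
    (f g : X → Fin K → ℝ) : |MCSD ρ D f g| ≤ K := by
  rw [MCSD_eq]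
  have := norm_integral_le_of_norm_le_const (μ := D)
    (f := fun x => scoringDistance ρ (f x) (g x)) (C := K)
    (ae_of_all _ fun x => by
      rw [Real.norm_of_nonneg (scoringDistance_nonneg _ _)]
      exact scoringDistance_le hρ _ _)
  simpa using this

theorem MCSD_sub_le_mcsdDivergence (hρ : 0 < ρ) (D D' : Measure X) [IsProbabilityMeasure D]
    [IsProbabilityMeasure D'] (p : F × F) :
    MCSD ρ D' p.1.1 p.2.1 - MCSD ρ D p.1.1 p.2.1 ≤ mcsdDivergence ρ F D D' :=
  le_ciSup (f := fun p : F × F => MCSD ρ D' p.1.1 p.2.1 - MCSD ρ D p.1.1 p.2.1)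
    (bddAbove_range_of_abs_le (C := K + K) fun _ =>
      (abs_sub _ _).trans (add_le_add (abs_MCSD_le hρ _ _ _) (abs_MCSD_le hρ _ _ _))) p

theorem MCSD_fst_eq (D : Measure (X × Fin K)) (hF : IsMeasurableClass F) (hρ : 0 < ρ)
    (p : F × F) :
    MCSD ρ D.fst p.1.1 p.2.1 = ∫ z, scoringDistance ρ (p.1.1 z.1) (p.2.1 z.1) ∂D := by
  rw [MCSD_eq, Measure.fst, integral_map measurable_fst.aemeasurable
    (measurable_scoringDistance hF hρ p).aestronglyMeasurable]

variable (D : Measure (X × Fin K)) [IsProbabilityMeasure D]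

theorem integrable_marginLoss (hF : IsMeasurableClass F) (hρ : 0 < ρ) (f : F) :
    Integrable (fun z : X × Fin K => marginLoss ρ (f.1 z.1) z.2) D := by
  have : Nonempty F := ⟨f⟩
  have h := isBoundedMeasurableFamily_marginLoss hF hρ
  exact Integrable.of_bound (h.measurable f).aestronglyMeasurable K
    (ae_of_all _ fun z => h.abs_le f z)

theorem integrable_scoringDistance (hF : IsMeasurableClass F) (hρ : 0 < ρ) (p : F × F) :
    Integrable (fun z : X × Fin K => scoringDistance ρ (p.1.1 z.1) (p.2.1 z.1)) D :=
  Integrable.of_bound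
    ((measurable_scoringDistance hF hρ p).comp measurable_fst).aestronglyMeasurable K
    (ae_of_all _ fun z => by
      rw [Real.norm_of_nonneg (scoringDistance_nonneg _ _)]
      exact scoringDistance_le hρ _ _)

theorem MCSD_fst_le_rampRisk_add (hF : IsMeasurableClass F) (hρ : 0 < ρ) (p : F × F) :
    MCSD ρ D.fst p.1.1 p.2.1 ≤ rampRisk ρ D p.1.1 + rampRisk ρ D p.2.1 := by
  rw [MCSD_fst_eq D hF hρ, rampRisk_eq, rampRisk_eq,
    ← integral_add (integrable_marginLoss D hF hρ p.1) (integrable_marginLoss D hF hρ p.2)]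
  exact integral_mono (integrable_scoringDistance D hF hρ p)
    ((integrable_marginLoss D hF hρ p.1).add (integrable_marginLoss D hF hρ p.2))
    fun z => scoringDistance_le_marginLoss_add hρ _ _ z.2

theorem zeroOneError_le (hF : IsMeasurableClass F) (hρ : 0 < ρ) (p : F × F)
    (hsum : ∀ x, ∑ k, p.1.1 x k = 0) {h : X → Fin K} (hh : Measurable h)
    (harg : IsArgmaxLabeling p.1.1 h) :
    zeroOneError D h ≤ MCSD ρ D.fst p.1.1 p.2.1 + rampRisk ρ D p.2.1 := by
  rw [MCSD_fst_eq D hF hρ, rampRisk_eq,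
    ← integral_add (integrable_scoringDistance D hF hρ p) (integrable_marginLoss D hF hρ p.2)]
  have hset : MeasurableSet {z : X × Fin K | h z.1 ≠ z.2} :=
    (measurableSet_eq_fun (hh.comp measurable_fst) measurable_snd).compl
  refine integral_mono (Integrable.of_bound
    (Measurable.ite hset measurable_const measurable_const).aestronglyMeasurable 1
    (ae_of_all _ fun z => ?_))
    ((integrable_scoringDistance D hF hρ p).add (integrable_marginLoss D hF hρ p.2))
    fun z => ite_ne_le_scoringDistance_add hρ (hsum z.1) (harg z.1) z.2
  split_ifs <;> simp

end Risks

/-! ### Deviation bounds for the risk and the disagreement. -/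

section GeneralizationBound

variable {X : Type*} [MeasurableSpace X] {K : ℕ} {F : Set (X → Fin K → ℝ)} {ρ : ℝ}
  {Ω : Type*} [MeasurableSpace Ω] {μ : Measure Ω} [IsProbabilityMeasure μ]

/-- Uniform deviation of the ramp risk on a labelled sample. -/
theorem exists_rampRisk_le (hF : IsMeasurableClass F) [Nonempty F] (hρ : 0 < ρ) (hK : 0 < K)
    (P : Measure (X × Fin K)) [IsProbabilityMeasure P] {n : ℕ} (hn : 0 < n)
    {S : Fin n → Ω → X × Fin K} (hS : ∀ i, Measurable (S i)) (hind : iIndepFun S μ)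
    (hlaw : ∀ i, μ.map (S i) = P) {δ : ℝ} (hδ : 0 < δ) (hδ1 : δ ≤ 1) :
    ∃ A : Set Ω, MeasurableSet A ∧ 1 - δ ≤ μ.real A ∧ ∀ ω ∈ A, ∀ C : ℝ,
      (∀ (g : Pi1 F) j, |g.1 (S j ω).1| ≤ C) → ∀ f : F,
      rampRisk ρ P f.1 ≤ rampRisk ρ (empiricalMeasure fun i => S i ω) f.1
        + 2 * K / ρ * (1 / (n : ℝ) * (1 / 2 ^ n *
            rademacherSum fun (g : Pi1 F) j => g.1 (S j ω).1))
        + 3 * K * √(Real.log (1 / δ) / (2 * n)) := by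
  have hfam := isBoundedMeasurableFamily_marginLoss hF hρ
  obtain ⟨A, hA, hμA, hdev⟩ := hfam.exists_uniform_deviation_of_iIndepFun P hn
    (by exact_mod_cast hK) hS hind hlaw hδ hδ1
  refine ⟨A, hA, hμA, fun ω hω C hC f => ?_⟩
  rw [rampRisk_eq, rampRisk_eq, integral_empiricalMeasure _ _ (hfam.measurable f)]
  refine (hdev ω hω f).trans (add_le_add_left (add_le_add_right ?_ _) _)
  have h := rademacherSum_marginLoss_le hρ hC fun j => (S j ω).2
  calc _ ≤ 2 * (1 / (n : ℝ) * (1 / 2 ^ n * (K / ρ *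
            rademacherSum fun (g : Pi1 F) j => g.1 (S j ω).1))) := by gcongr
    _ = _ := by ring

/-- Uniform deviation of the scoring disagreement on an unlabelled sample, in the direction given
by the sign `s`. -/
theorem exists_MCSD_le (hF : IsMeasurableClass F) [Nonempty F] (hρ : 0 < ρ) (hK : 0 < K)
    (P : Measure X) [IsProbabilityMeasure P] {n : ℕ} (hn : 0 < n)
    {S : Fin n → Ω → X} (hS : ∀ i, Measurable (S i)) (hind : iIndepFun S μ)
    (hlaw : ∀ i, μ.map (S i) = P) {δ : ℝ} (hδ : 0 < δ) (hδ1 : δ ≤ 1) {s : ℝ} (hs : |s| = 1) :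
    ∃ A : Set Ω, MeasurableSet A ∧ 1 - δ ≤ μ.real A ∧ ∀ ω ∈ A, ∀ C : ℝ,
      (∀ (g : Pi1 F) j, |g.1 (S j ω)| ≤ C) → ∀ p : F × F,
      s * MCSD ρ P p.1.1 p.2.1 ≤ s * MCSD ρ (empiricalMeasure fun i => S i ω) p.1.1 p.2.1
        + 4 * K / ρ * (1 / (n : ℝ) * (1 / 2 ^ n *
            rademacherSum fun (g : Pi1 F) j => g.1 (S j ω)))
        + 3 * K * √(Real.log (1 / δ) / (2 * n)) := by
  have hfam := isBoundedMeasurableFamily_scoringDistance hF hρ hs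
  obtain ⟨A, hA, hμA, hdev⟩ := hfam.exists_uniform_deviation_of_iIndepFun P hn
    (by exact_mod_cast hK) hS hind hlaw hδ hδ1
  refine ⟨A, hA, hμA, fun ω hω C hC p => ?_⟩
  rw [MCSD_eq, MCSD_eq, ← integral_const_mul, ← integral_const_mul,
    integral_empiricalMeasure _ _ (hfam.measurable p)]
  refine (hdev ω hω p).trans (add_le_add_left (add_le_add_right ?_ _) _)
  have h := rademacherSum_scoringDistance_le hρ hC hs
  calc _ ≤ 2 * (1 / (n : ℝ) * (1 / 2 ^ n * (2 * K / ρ *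
            rademacherSum fun (g : Pi1 F) j => g.1 (S j ω)))) := by gcongr
    _ = _ := by ring

/-- A union bound, so no independence between the source and target samples is needed. -/
theorem one_sub_three_mul_le_measureReal_inter {A B C : Set Ω} {δ : ℝ} (hA : MeasurableSet A)
    (hB : MeasurableSet B) (hC : MeasurableSet C) (hμA : 1 - δ ≤ μ.real A)
    (hμB : 1 - δ ≤ μ.real B) (hμC : 1 - δ ≤ μ.real C) :
    1 - 3 * δ ≤ μ.real (A ∩ B ∩ C) := by
  have h := measureReal_compl (μ := μ) ((hA.inter hB).inter hC)
  rw [Set.compl_inter, Set.compl_inter, probReal_univ] at h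
  have h1 := measureReal_union_le (μ := μ) (Aᶜ ∪ Bᶜ) Cᶜ
  have h2 := measureReal_union_le (μ := μ) Aᶜ Bᶜ
  rw [probReal_compl_eq_one_sub hA, probReal_compl_eq_one_sub hB] at h2
  rw [probReal_compl_eq_one_sub hC] at h1
  linarith

end GeneralizationBound

end MultiClassUDA

/-! ### The main theorem. -/

open MultiClassUDA in
theorem theorem2 {X : Type*} [MeasurableSpace X] {K : ℕ}
    (F : Set (X → Fin K → ℝ)) (hF : IsMeasurableClass F)
    (hsum : ∀ f ∈ F, ∀ x, ∑ k, f x k = 0)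
    (P Q : Measure (X × Fin K)) [IsProbabilityMeasure P] [IsProbabilityMeasure Q]
    (ns nt : ℕ) (hns : 0 < ns) (hnt : 0 < nt)
    {Ω : Type*} [MeasurableSpace Ω] (μ : Measure Ω) [IsProbabilityMeasure μ]
    (S : Fin ns → Ω → X × Fin K) (hS : ∀ i, Measurable (S i))
    (hSind : iIndepFun S μ) (hSlaw : ∀ i, μ.map (S i) = P)
    (T : Fin nt → Ω → X) (hT : ∀ j, Measurable (T j))
    (hTind : iIndepFun T μ) (hTlaw : ∀ j, μ.map (T j) = Q.fst)
    (ρ : ℝ) (hρ : 0 < ρ) (δ : ℝ) (hδ : 0 < δ) :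
    ∃ A : Set Ω, MeasurableSet A ∧ 1 - 3 * δ ≤ μ.real A ∧
      ∀ ω ∈ A, ∀ f ∈ F, ∀ h : X → Fin K, Measurable h → IsArgmaxLabeling f h →
        (zeroOneError Q h : EReal) ≤
          (rampRisk ρ (empiricalMeasure fun i => S i ω) f : EReal)
          + (mcsdDivergence ρ F (empiricalMeasure fun i => (S i ω).1)
              (empiricalMeasure fun j => T j ω) : EReal)
          + ((2 * (K : ℝ) ^ 2 / ρ + 4 * (K : ℝ) / ρ : ℝ) : EReal)
              * empRademacher (Pi1 F) (fun i => (S i ω).1)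
          + ((4 * (K : ℝ) / ρ : ℝ) : EReal) * empRademacher (Pi1 F) (fun j => T j ω)
          + ((6 * (K : ℝ) * √(Real.log (4 / δ) / (2 * (ns : ℝ))) : ℝ) : EReal)
          + ((3 * (K : ℝ) * √(Real.log (4 / δ) / (2 * (nt : ℝ))) : ℝ) : EReal)
          + (jointRisk ρ F P Q : EReal) := by
  rcases lt_or_ge 1 δ with hδ1 | hδ1
  · exact ⟨∅, MeasurableSet.empty, by rw [measureReal_empty]; linarith, by simp⟩
  rcases F.eq_empty_or_nonempty with rfl | hne
  · exact ⟨Set.univ, MeasurableSet.univ, by rw [probReal_univ]; linarith, by simp⟩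
  have : Nonempty F := hne.to_subtype
  -- The space carrying the probability measure `Q` is nonempty, which forces `K > 0`.
  obtain ⟨x₀, k₀⟩ := Q.nonempty_of_neZero.some
  have hK : 0 < K := k₀.pos
  have hK1 : (1 : ℝ) ≤ K := by exact_mod_cast hK
  obtain ⟨f₀, hf₀⟩ := hne
  have hPi : (Pi1 F).Nonempty := ⟨_, f₀, hf₀, k₀, rfl⟩
  have : Nonempty (Pi1 F) := hPi.to_subtype
  have hS1 : ∀ i, Measurable fun ω => (S i ω).1 := fun i => measurable_fst.comp (hS i)
  have hS1ind : iIndepFun (fun i ω => (S i ω).1) μ :=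
    hSind.comp (fun _ => Prod.fst) fun _ => measurable_fst
  have hS1law : ∀ i, μ.map (fun ω => (S i ω).1) = P.fst := fun i => by
    rw [Measure.fst, ← hSlaw i, Measure.map_map measurable_fst (hS i)]
    rfl
  obtain ⟨A₁, hA₁, hμ₁, h₁⟩ := exists_rampRisk_le hF hρ hK P hns hS hSind hSlaw hδ hδ1
  -- The sign `-1` bounds the empirical disagreement by the true one on the source; the target needs
  -- the opposite direction.
  obtain ⟨A₂, hA₂, hμ₂, h₂⟩ := exists_MCSD_le hF hρ hK P.fst hns hS1 hS1ind hS1law hδ hδ1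
    (s := -1) (by simp)
  obtain ⟨A₃, hA₃, hμ₃, h₃⟩ := exists_MCSD_le hF hρ hK Q.fst hnt hT hTind hTlaw hδ hδ1 abs_one
  refine ⟨A₁ ∩ A₂ ∩ A₃, (hA₁.inter hA₂).inter hA₃,
    one_sub_three_mul_le_measureReal_inter hA₁ hA₂ hA₃ hμ₁ hμ₂ hμ₃, ?_⟩
  rintro ω ⟨⟨hω₁, hω₂⟩, hω₃⟩ f hf h hh harg
  have hc₁ : (0 : ℝ) < 2 * (K : ℝ) ^ 2 / ρ + 4 * (K : ℝ) / ρ := by positivity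
  have hc₂ : (0 : ℝ) < 4 * (K : ℝ) / ρ := by positivity
  -- An infinite complexity, having a positive coefficient, makes the right side `⊤`; otherwise both
  -- samples have the boundedness needed by the real-valued estimates.
  rcases empRademacher_eq_top_or hns (Pi1 F) hPi (fun i => (S i ω).1) with hRS | ⟨⟨C, hC⟩, hRS⟩
  · rw [hRS, EReal.coe_mul_top_of_pos hc₁, ← EReal.coe_add, EReal.coe_add_top]
    rcases empRademacher_eq_top_or hnt (Pi1 F) hPi (fun j => T j ω) with hRT | ⟨-, hRT⟩
    · rw [hRT, EReal.coe_mul_top_of_pos hc₂, EReal.top_add_top]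
      simp only [EReal.top_add_coe, le_top]
    · rw [hRT, ← EReal.coe_mul]
      simp only [EReal.top_add_coe, le_top]
  rcases empRademacher_eq_top_or hnt (Pi1 F) hPi (fun j => T j ω) with hRT | ⟨⟨D, hD⟩, hRT⟩
  · rw [hRS, hRT, EReal.coe_mul_top_of_pos hc₂, ← EReal.coe_mul, ← EReal.coe_add,
      ← EReal.coe_add, EReal.coe_add_top]
    simp only [EReal.top_add_coe, le_top]
  have hRS0 : 0 ≤ 1 / (ns : ℝ) * (1 / 2 ^ ns *
      rademacherSum fun (g : Pi1 F) j => g.1 (S j ω).1) :=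
    mul_nonneg (by positivity) (mul_nonneg (by positivity) (rademacherSum_nonneg hC))
  have e₁ := h₁ ω hω₁ C hC ⟨f, hf⟩
  have e₂ := h₂ ω hω₂ C hC
  have e₃ := h₃ ω hω₃ D hD
  rw [hRS, hRT]
  set RS := 1 / (ns : ℝ) * (1 / 2 ^ ns * rademacherSum fun (g : Pi1 F) j => g.1 (S j ω).1)
  set RT := 1 / (nt : ℝ) * (1 / 2 ^ nt * rademacherSum fun (g : Pi1 F) j => g.1 (T j ω))
  have hprobS := isProbabilityMeasure_empiricalMeasure hns fun i => (S i ω).1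
  have hprobT := isProbabilityMeasure_empiricalMeasure hnt fun j => T j ω
  -- The estimates give `log (1 / δ)` and `2K / ρ`; the stated `log (4 / δ)` and `2K² / ρ` are
  -- weaker, the latter because `RS ≥ 0` and `K ≥ 1`.
  have hsqrt : ∀ n : ℕ, √(Real.log (1 / δ) / (2 * n)) ≤ √(Real.log (4 / δ) / (2 * n)) := fun n => by
    have : Real.log (1 / δ) ≤ Real.log (4 / δ) :=
      Real.log_le_log (by positivity) (by gcongr; norm_num)
    gcongr
  have hcoef : 2 * K / ρ * RS ≤ 2 * (K : ℝ) ^ 2 / ρ * RS := by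
    gcongr
    nlinarith
  have hdevS := mul_le_mul_of_nonneg_left (hsqrt ns) (by positivity : (0 : ℝ) ≤ 3 * K)
  have hdevT := mul_le_mul_of_nonneg_left (hsqrt nt) (by positivity : (0 : ℝ) ≤ 3 * K)
  simp only [← EReal.coe_mul, ← EReal.coe_add]
  rw [EReal.coe_le_coe_iff, ← sub_le_iff_le_add']
  -- It suffices to compare with an arbitrary `g`, so the infimum `λ` need not be attained.
  refine le_ciInf fun g => ?_
  have b₁ := zeroOneError_le Q hF hρ (⟨f, hf⟩, g) (hsum f hf) hh harg
  have b₂ := e₃ (⟨f, hf⟩, g)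
  have b₃ := MCSD_sub_le_mcsdDivergence hρ (empiricalMeasure fun i => (S i ω).1)
    (empiricalMeasure fun j => T j ω) ((⟨f, hf⟩, g) : F × F)
  have b₄ := e₂ (⟨f, hf⟩, g)
  have b₅ := MCSD_fst_le_rampRisk_add P hF hρ (⟨f, hf⟩, g)
  simp only at *
  linarith
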